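/- Let $\mathbb{H}$ be the skew-field of quaternions, $\mathbb{D}=\{x\in\mathbb{H}:|x|<1\}$ and $\mathbb{S}=\{x\in\mathbb{H}:\operatorname{Re}x=0,\ |x|=1\}$; for $i\in\mathbb{S}$ and $\theta\in\mathbb{R}$ write $e^{i\theta}=\cos\theta+i\sin\theta$. A real differentiable function $f:\mathbb{D}\to\mathbb{H}$ is (left) slice hyperholomorphic if there are $\mathbb{H}$-valued functions $\alpha,\beta$ of two real variables with $f(x_0+ix_1)=\alpha(x_0,x_1)+i\beta(x_0,x_1)$ for all $i\in\mathbb{S}$ and all $x_0+ix_1\in\mathbb{D}$, with $\alpha(x_0,-x_1)=\alpha(x_0,x_1)$, $\beta(x_0,-x_1)=-\beta(x_0,x_1)$, and with $\partial_{x_0}\alpha=\partial_{x_1}\beta$, $\partial_{x_0}\beta=-\partial_{x_1}\alpha$. The Hardy space $\mathcal{H}^2(\mathbb{D})$ consists of the slice hyperholomorphic $f$ on $\mathbb{D}$ with $$\sup_{i\in\mathbb{S}}\lim_{r\nearrow1}\Big(\frac1{2\pi}\int_0^{2\pi}|f(re^{i\theta})|^2\,d\theta\Big)^{1/2}<+\infty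 .$$ For $f\in\mathcal{H}^2(\mathbb{D})$ and $i\in\mathbb{S}$ let $f(e^{i\theta})=\lim_{r\nearrow1}f(re^{i\theta})$ denote the radial limit, which exists for almost every $\theta$, and put $$|f|_{\mathrm{BMOSH}(\mathbb{D}_i)}=\sup_{I}\Big(\frac1{|I|}\int_I\big|f(e^{i\theta})-f_{I,i}\big|^2\,d\theta\Big)^{1/2},\qquad f_{I,i}=\frac1{|I|}\int_I f(e^{i\theta})\,d\theta ,$$ where $I$ runs over the intervals $(a,b)\subset\mathbb{R}$ with $0<|I|=b-a\le2\pi$. Let $|f|_{\mathrm{BMOSH}(\mathbb{D})}=\sup_{i\in\mathbb{S}}|f|_{\mathrm{BMOSH}(\mathbb{D}_i)}$, and let $\mathrm{BMOSH}(\mathbb{D})$ be the set of all $f\in\mathcal{H}^2(\mathbb{D})$ with $|f|_{\mathrm{BMOSH}(\mathbb{D})}<+\infty$. **Lemma.** For every $i\in\mathbb{S}$, the set $\mathrm{BMOSH}(\mathbb{D})$ with pointwise addition, the right multiplication $(fa)(x)=f(x)a$ by $a\in\mathbb{H}$, and $$\|f\|_{\mathrm{BMOSH}(\mathbb{D}_i)}=|f(0)|+|f|_{\mathrm{BMOSH}(\mathbb{D}_i)}$$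 is a quaternionic right Banach space, i.e. it is a right vector space over $\mathbb{H}$, the displayed expression is a norm on it (with $\|fa\|=\|f\|\,|a|$ for $a\in\mathbb{H}$), and it is complete for this norm. Likewise $\mathrm{BMOSH}(\mathbb{D})$ is a quaternionic right Banach space with the norm $$\|f\|_{\mathrm{BMOSH}(\mathbb{D})}=|f(0)|+|f|_{\mathrm{BMOSH}(\mathbb{D})}.$$ Moreover, for every $i\in\mathbb{S}$ the norms $\|\cdot\|_{\mathrm{BMOSH}(\mathbb{D}_i)}$ and $\|\cdot\|_{\mathrm{BMOSH}(\mathbb{D})}$ on $\mathrm{BMOSH}(\mathbb{D})$ are equivalent, i.e. there are constants $c,C>0$ with $c\,\|f\|_{\mathrm{BMOSH}(\mathbb{D}_i)}\le\|f\|_{\mathrm{BMOSH}(\mathbb{D})}\le C\,\|f\|_{\mathrm{BMOSH}(\mathbb{D}_i)}$ for all $f\in\mathrm{BMOSH}(\mathbb{D})$. -/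

import Mathlib

open scoped Quaternion ENNReal Topology
open MeasureTheory Filter

noncomputable section

namespace BMOSH

/-- The sphere of imaginary units of the quaternions. -/
def imUnits : Set ℍ[ℝ] := {i | i.re = 0 ∧ ‖i‖ = 1}

/-- The point `x + i y` of the slice determined by `i`. -/
def slicePoint (i : ℍ[ℝ]) (x y : ℝ) : ℍ[ℝ] := (x : ℍ[ℝ]) + i * (y : ℍ[ℝ])

/-- The point `r e^{iθ} = r cos θ + i r sin θ` of the slice determined by `i`. -/
def polarPoint (i : ℍ[ℝ]) (r θ : ℝ) : ℍ[ℝ] :=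
  slicePoint i (r * Real.cos θ) (r * Real.sin θ)

/-- Left slice hyperholomorphic functions on an (axially symmetric, open) set `U`. -/
def IsSliceHyperholomorphicOn (U : Set ℍ[ℝ]) (f : ℍ[ℝ] → ℍ[ℝ]) : Prop :=
  DifferentiableOn ℝ f U ∧
  ∃ α β : ℝ → ℝ → ℍ[ℝ], ∀ i ∈ imUnits, ∀ x y : ℝ, slicePoint i x y ∈ U →
    f (slicePoint i x y) = α x y + i * β x y ∧
    α x (-y) = α x y ∧ β x (-y) = -β x y ∧
    -- the Cauchy-Riemann system; the partial derivatives are required to exist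
    ∃ a b : ℍ[ℝ],
      HasDerivAt (fun t => α t y) a x ∧ HasDerivAt (fun t => β x t) a y ∧
      HasDerivAt (fun t => β t y) b x ∧ HasDerivAt (fun t => α x t) (-b) y

/-- The open unit ball of the quaternions. -/
abbrev unitBall : Set ℍ[ℝ] := Metric.ball 0 1

/-- The centre of the unit ball. -/
def center : unitBall := ⟨0, Metric.mem_ball_self one_pos⟩

/-- Extension by zero of a function on the unit ball; its values outside the ball are never used. -/
def zeroExt (f : unitBall → ℍ[ℝ]) : ℍ[ℝ] → ℍ[ℝ] := Function.extend Subtype.val f 0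

/-- The integral mean `((2π)⁻¹ ∫₀^{2π} |f(r e^{iθ})|² dθ)^{1/2}`, for `0 ≤ r < 1`. -/
def hardyMean (f : unitBall → ℍ[ℝ]) (i : ℍ[ℝ]) (r : ℝ) : ℝ≥0∞ :=
  (ENNReal.ofReal (1 / (2 * Real.pi)) *
    ∫⁻ θ in Set.Ioo 0 (2 * Real.pi), ‖zeroExt f (polarPoint i r θ)‖ₑ ^ 2) ^ (1 / 2 : ℝ)

/-- The Hardy norm `sup_i lim_{r ↗ 1} hardyMean f i r`. For slice hyperholomorphic `f` the means
increase with `r`, so that the limit exists in `[0, ∞]` and is the upper limit used here. -/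
def hardyNorm (f : unitBall → ℍ[ℝ]) : ℝ≥0∞ :=
  ⨆ i ∈ imUnits, limsup (fun r => hardyMean f i r) (𝓝[<] (1 : ℝ))

/-- The Hardy space `H²` of slice hyperholomorphic functions on the unit ball. -/
def hardySpace : Set (unitBall → ℍ[ℝ]) :=
  {f | IsSliceHyperholomorphicOn unitBall (zeroExt f) ∧ hardyNorm f < ∞}

/-- The boundary value `f(e^{iθ})`, i.e. the radial limit of `f(r e^{iθ})` as `r ↗ 1`. -/
def radialLimit (f : unitBall → ℍ[ℝ]) (i : ℍ[ℝ]) (θ : ℝ) : ℍ[ℝ] :=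
  limUnder (𝓝[<] (1 : ℝ)) (fun r => zeroExt f (polarPoint i r θ))

/-- The average of the boundary values of `f` over the interval `(a, b)`. -/
def boundaryAverage (f : unitBall → ℍ[ℝ]) (i : ℍ[ℝ]) (a b : ℝ) : ℍ[ℝ] :=
  (1 / (b - a)) • ∫ θ in Set.Ioo a b, radialLimit f i θ

/-- The mean quadratic oscillation `|I|⁻¹ ∫_I |f(e^{iθ}) - f_{I,i}|² dθ` over `I = (a, b)`. -/
def meanOscillation (f : unitBall → ℍ[ℝ]) (i : ℍ[ℝ]) (a b : ℝ) : ℝ≥0∞ :=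
  ENNReal.ofReal (1 / (b - a)) *
    ∫⁻ θ in Set.Ioo a b, ‖radialLimit f i θ - boundaryAverage f i a b‖ₑ ^ 2

/-- The slicewise BMO seminorm, with values in `[0, ∞]`. -/
def sliceSeminorm (i : ℍ[ℝ]) (f : unitBall → ℍ[ℝ]) : ℝ≥0∞ :=
  (⨆ (a : ℝ) (b : ℝ) (_ : a < b) (_ : b - a ≤ 2 * Real.pi), meanOscillation f i a b) ^ (1 / 2 : ℝ)

/-- The global BMO seminorm, with values in `[0, ∞]`. -/
def globalSeminorm (f : unitBall → ℍ[ℝ]) : ℝ≥0∞ :=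
  ⨆ i ∈ imUnits, sliceSeminorm i f

/-- The space of slice hyperholomorphic functions of bounded mean oscillation. -/
def bmoSpace : Set (unitBall → ℍ[ℝ]) :=
  {f | f ∈ hardySpace ∧ globalSeminorm f < ∞}

/-- The norm `|f(0)| + |f|_i`; on `bmoSpace` the seminorm is finite. -/
def sliceNorm (i : ℍ[ℝ]) (f : unitBall → ℍ[ℝ]) : ℝ :=
  ‖f center‖ + (sliceSeminorm i f).toReal

/-- The norm `|f(0)| + sup_i |f|_i`; on `bmoSpace` the seminorm is finite. -/
def globalNorm (f : unitBall → ℍ[ℝ]) : ℝ :=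
  ‖f center‖ + (globalSeminorm f).toReal

/-- The set `V` is a right linear subspace over the quaternions, and `N` is a norm on `V` for which
`V` is complete. A right vector space is a module over the opposite ring: `op a • f` is `f a`. -/
structure IsRightBanachSpace {E : Type*} [AddCommGroup E] [Module ℍ[ℝ]ᵐᵒᵖ E]
    (V : Set E) (N : E → ℝ) : Prop where
  zero_mem : (0 : E) ∈ V
  add_mem : ∀ f ∈ V, ∀ g ∈ V, f + g ∈ V
  smul_mem : ∀ f ∈ V, ∀ a : ℍ[ℝ], MulOpposite.op a • f ∈ V
  nonneg : ∀ f ∈ V, 0 ≤ N f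
  eq_zero_iff : ∀ f ∈ V, N f = 0 ↔ f = 0
  add_le : ∀ f ∈ V, ∀ g ∈ V, N (f + g) ≤ N f + N g
  smul_eq : ∀ f ∈ V, ∀ a : ℍ[ℝ], N (MulOpposite.op a • f) = N f * ‖a‖
  complete : ∀ u : ℕ → E, (∀ n, u n ∈ V) →
    (∀ ε > 0, ∃ n₀, ∀ m ≥ n₀, ∀ n ≥ n₀, N (u m - u n) < ε) →
    ∃ f ∈ V, Tendsto (fun n => N (u n - f)) atTop (𝓝 0)

/-- Equivalence of the norms `N` and `M` on the set `V`. -/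
def EquivalentOn {E : Type*} (V : Set E) (N M : E → ℝ) : Prop :=
  ∃ c > 0, ∃ C > 0, ∀ f ∈ V, c * N f ≤ M f ∧ M f ≤ C * N f

end BMOSH

end

/-! A slice hyperholomorphic function on the ball is a power series `∑ x ^ n * a n` with right
quaternionic coefficients, and it lies in the Hardy space exactly when `∑ ‖a n‖ ^ 2` is finite
(`mem_hardySpace_iff`). The coefficients do not depend on the slice. On the slice of a unit `i`,
left multiplication by `x + iy` turns the quaternions into a complex Hilbert space, so the classical
theory of Hilbert-valued power series applies there: radial limits exist almost everywhere
(`exists_radial_limit`), and Parseval's identity holds for the boundary values.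

Fatou's theorem is proved without maximal functions. The boundary series, stripped of its constant
term, is integrated termwise to a continuous primitive, which is differentiable almost everywhere by
Lebesgue's theorem. The Poisson integral of the boundary function becomes an integral of difference
quotients of the primitive against a nonnegative peak kernel, so it converges wherever the primitive
is differentiable.

Equivalence of the norms rests on the representation formula `f(x+jy) = ½(1-ji) f(x+iy) + ½(1+ji)
f(x-iy)`. It passes to the boundary. Its coefficients have norm at most 1, and `θ ↦ -θ` maps
intervals to intervals of the same length, so the seminorm on any slice is at most twice the
seminorm on the slice of `i` (`HasCoeff.globalSeminorm_le`).

Definiteness and completeness rest on the interval of length `2π`: by Parseval the oscillation there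
bounds `∑_{n≥1} ‖a n‖ ^ 2`, hence the norm dominates the Hardy norm (`HasCoeff.ofReal_tsum_le`). A
Cauchy sequence therefore has a limit in the Hardy space. On each fixed interval the oscillation is
continuous in the Hardy norm, so Cauchy bounds survive the limit interval by interval, and then in
the supremum. Completeness for the global norm follows by equivalence. -/

noncomputable section

namespace BMOSH

/-! ### Orthogonality of the exponentials and Parseval's identity -/

section
/-- The point `e^{iθ}` of the complex unit circle. -/
def circ (θ : ℝ) : ℂ := Complex.exp (θ * Complex.I)

lemma norm_circ (θ : ℝ) : ‖circ θ‖ = 1 := Complex.norm_exp_ofReal_mul_I θ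

lemma circ_ne_zero (θ : ℝ) : circ θ ≠ 0 := Complex.exp_ne_zero _

@[fun_prop]
lemma continuous_circ : Continuous circ := by unfold circ; fun_prop

lemma circ_add (s t : ℝ) : circ (s + t) = circ s * circ t := by
  simp [circ, add_mul, Complex.exp_add]

lemma conj_circ (θ : ℝ) : (starRingEnd ℂ) (circ θ) = (circ θ)⁻¹ := by
  simp [circ, ← Complex.exp_conj, ← Complex.exp_neg]

lemma circ_zpow (θ : ℝ) (k : ℤ) : circ θ ^ k = Complex.exp (k * Complex.I * θ) := by
  rw [circ, ← Complex.exp_int_mul]; ring_nf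

lemma circ_two_pi : circ (2 * Real.pi) = 1 := by
  simp [circ, Complex.exp_two_pi_mul_I]

lemma integral_circ_zpow (k : ℤ) (a : ℝ) :
    ∫ t in a..a + 2 * Real.pi, circ t ^ k = if k = 0 then (2 * Real.pi : ℂ) else 0 := by
  split_ifs with h
  · simp [h]
  · have hk : (k * Complex.I : ℂ) ≠ 0 := by simp [h]
    simp_rw [circ_zpow]
    rw [integral_exp_mul_complex hk, ← circ_zpow, ← circ_zpow, circ_add, circ_two_pi]
    simp

lemma integral_circ_pow_mul_conj (m n : ℕ) (a : ℝ) :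
    ∫ t in a..a + 2 * Real.pi, (starRingEnd ℂ) (circ t ^ n) * circ t ^ m
      = if m = n then (2 * Real.pi : ℂ) else 0 := by
  have : ∀ t, (starRingEnd ℂ) (circ t ^ n) * circ t ^ m = circ t ^ ((m : ℤ) - n) := by
    intro t
    rw [zpow_sub₀ (circ_ne_zero t), map_pow, conj_circ]
    simp [div_eq_mul_inv, mul_comm]
  simp_rw [this]
  rw [integral_circ_zpow]
  simp [sub_eq_zero]

/-- The square of the `L²` seminorm is the integral of the squared norm. -/
lemma eLpNorm_two_sq {X E : Type*} [MeasurableSpace X] [NormedAddCommGroup E] (h : X → E)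
    (μ : Measure X) : eLpNorm h 2 μ ^ 2 = ∫⁻ x, ‖h x‖ₑ ^ 2 ∂μ := by
  have := eLpNorm_nnreal_pow_eq_lintegral (μ := μ) (f := h) (p := 2) (by simp)
  simpa using! this

lemma lintegral_norm_sq_eq_ofReal {E : Type*} [NormedAddCommGroup E] {h : ℝ → E}
    (hh : Continuous h) (a b : ℝ) (hab : a ≤ b) :
    ∫⁻ t in Set.Ioc a b, ‖h t‖ₑ ^ 2 = ENNReal.ofReal (∫ t in a..b, ‖h t‖ ^ 2) := by
  rw [intervalIntegral.integral_of_le hab, ofReal_integral_eq_lintegral_ofReal]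
  · refine lintegral_congr fun t => ?_
    rw [ENNReal.ofReal_pow (norm_nonneg _), ofReal_norm]
  · have : Continuous fun t => ‖h t‖ ^ 2 := by fun_prop
    exact this.integrableOn_Ioc
  · exact Eventually.of_forall fun t => by positivity

variable {E : Type*} [NormedAddCommGroup E] [InnerProductSpace ℂ E]

lemma continuous_circ_pow_smul (n : ℕ) (c : E) : Continuous fun t : ℝ => circ t ^ n • c := by
  fun_prop

lemma norm_circ_pow_smul (t : ℝ) (n : ℕ) (c : E) : ‖circ t ^ n • c‖ = ‖c‖ := by
  simp [norm_smul, norm_circ]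

/-- Parseval's identity for trigonometric polynomials. -/
lemma integral_norm_sq_sum (s : Finset ℕ) (a : ℕ → E) :
    ∫ t in (0 : ℝ)..2 * Real.pi, ‖∑ n ∈ s, circ t ^ n • a n‖ ^ 2
      = 2 * Real.pi * ∑ n ∈ s, ‖a n‖ ^ 2 := by
  have key : ∫ t in (0 : ℝ)..2 * Real.pi, ((‖∑ n ∈ s, circ t ^ n • a n‖ ^ 2 : ℝ) : ℂ)
      = ((2 * Real.pi * ∑ n ∈ s, ‖a n‖ ^ 2 : ℝ) : ℂ) := by
    have h1 : ∀ t : ℝ, ((‖∑ n ∈ s, circ t ^ n • a n‖ ^ 2 : ℝ) : ℂ)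
        = ∑ m ∈ s, ∑ n ∈ s, (starRingEnd ℂ) (circ t ^ n) * circ t ^ m * inner ℂ (a n) (a m) := by
      intro t
      have := inner_self_eq_norm_sq_to_K (𝕜 := ℂ) (∑ n ∈ s, circ t ^ n • a n)
      push_cast
      rw [show ((‖∑ n ∈ s, circ t ^ n • a n‖ : ℂ)) ^ 2
        = inner ℂ (∑ n ∈ s, circ t ^ n • a n) (∑ n ∈ s, circ t ^ n • a n) from this.symm]
      rw [inner_sum]
      refine Finset.sum_congr rfl fun m _ => ?_
      rw [sum_inner]
      refine Finset.sum_congr rfl fun n _ => ?_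
      rw [inner_smul_left, inner_smul_right]; ring
    simp_rw [h1]
    have hc : ∀ m n : ℕ, Continuous fun t : ℝ =>
        (starRingEnd ℂ) (circ t ^ n) * circ t ^ m * inner ℂ (a n) (a m) := by
      intro m n
      exact ((Complex.continuous_conj.comp (by fun_prop)).mul (by fun_prop)).mul continuous_const
    rw [intervalIntegral.integral_finsetSum
      fun m _ => (continuous_finsetSum _ fun n _ => hc m n).intervalIntegrable _ _]
    have h2 : ∀ m n : ℕ, ∫ t in (0 : ℝ)..2 * Real.pi,
        (starRingEnd ℂ) (circ t ^ n) * circ t ^ m * inner ℂ (a n) (a m)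
        = if m = n then 2 * Real.pi * inner ℂ (a n) (a m) else 0 := by
      intro m n
      have := integral_circ_pow_mul_conj m n 0
      rw [zero_add] at this
      rw [intervalIntegral.integral_mul_const, this]
      split_ifs <;> simp
    have h3 : ∀ m ∈ s, ∫ t in (0 : ℝ)..2 * Real.pi,
        ∑ n ∈ s, (starRingEnd ℂ) (circ t ^ n) * circ t ^ m * inner ℂ (a n) (a m)
        = 2 * Real.pi * (‖a m‖ : ℂ) ^ 2 := by
      intro m hm
      rw [intervalIntegral.integral_finsetSum fun n _ => (hc m n).intervalIntegrable _ _]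
      simp_rw [h2]
      rw [Finset.sum_ite_eq s m, if_pos hm, inner_self_eq_norm_sq_to_K]
      rfl
    rw [Finset.sum_congr rfl h3]
    push_cast
    rw [Finset.mul_sum]
  rw [intervalIntegral.integral_ofReal] at key
  exact_mod_cast key

/-- Parseval's identity for absolutely convergent trigonometric series. -/
lemma lintegral_norm_sq_tsum [CompleteSpace E] {c : ℕ → E} (hc : Summable fun n => ‖c n‖) :
    ∫⁻ t in Set.Ioc 0 (2 * Real.pi), ‖∑' n, circ t ^ n • c n‖ₑ ^ 2
      = ENNReal.ofReal (2 * Real.pi * ∑' n, ‖c n‖ ^ 2) := by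
  have hb : ∀ (n : ℕ) (t : ℝ), ‖circ t ^ n • c n‖ ≤ ‖c n‖ := fun n t =>
    (norm_circ_pow_smul t n (c n)).le
  have hcont : Continuous fun t : ℝ => ∑' n, circ t ^ n • c n :=
    continuous_tsum (fun n => continuous_circ_pow_smul n (c n)) hc hb
  rw [lintegral_norm_sq_eq_ofReal hcont _ _ (by positivity)]
  congr 1
  -- Summable terms are eventually below 1, so their squares are eventually smaller than the terms.
  have hsq : Summable fun n => ‖c n‖ ^ 2 := by
    refine Summable.of_norm_bounded_eventually_nat hc ?_
    filter_upwards [hc.tendsto_atTop_zero.eventually (gt_mem_nhds one_pos)] with n hn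
    rw [Real.norm_of_nonneg (by positivity), sq]
    exact mul_le_of_le_one_left (norm_nonneg _) hn.le
  have h1 : Tendsto (fun N => 2 * Real.pi * ∑ n ∈ Finset.range N, ‖c n‖ ^ 2) atTop
      (𝓝 (2 * Real.pi * ∑' n, ‖c n‖ ^ 2)) :=
    (hsq.hasSum.tendsto_sum_nat).const_mul _
  refine tendsto_nhds_unique ?_ h1
  simp_rw [← integral_norm_sq_sum]
  refine intervalIntegral.tendsto_integral_filter_of_dominated_convergence
    (fun _ => (∑' n, ‖c n‖) ^ 2) ?_ ?_ ?_ ?_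
  · refine Eventually.of_forall fun N => Continuous.aestronglyMeasurable ?_
    have : Continuous fun t : ℝ => ∑ n ∈ Finset.range N, circ t ^ n • c n :=
      continuous_finsetSum _ fun n _ => continuous_circ_pow_smul n (c n)
    fun_prop
  · refine Eventually.of_forall fun N => Eventually.of_forall fun t _ => ?_
    rw [Real.norm_of_nonneg (by positivity)]
    gcongr
    refine (norm_sum_le _ _).trans ?_
    refine (Finset.sum_le_sum fun n _ => hb n t).trans ?_
    exact hc.sum_le_tsum _ fun n _ => norm_nonneg _
  · simp
  · refine Eventually.of_forall fun t _ => ?_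
    have : Summable fun n => circ t ^ n • c n := Summable.of_norm_bounded hc fun n => hb n t
    exact (this.hasSum.tendsto_sum_nat.norm).pow 2

end

/-! ### The derivative of the Poisson kernel and the associated peak kernel -/

/-- The derivative of the Poisson kernel, up to sign. -/
def derivKernel (r t : ℝ) : ℝ :=
  2 * r * (1 - r ^ 2) * Real.sin t / (1 - 2 * r * Real.cos t + r ^ 2) ^ 2

lemma denom_eq (r t : ℝ) :
    1 - 2 * r * Real.cos t + r ^ 2 = (1 - r) ^ 2 + 2 * r * (1 - Real.cos t) := by ring

lemma denom_pos {r : ℝ} (h0 : 0 ≤ r) (h1 : r < 1) (t : ℝ) :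
    0 < 1 - 2 * r * Real.cos t + r ^ 2 := by
  rw [denom_eq]
  have : 0 < (1 - r) ^ 2 := by have : 0 < 1 - r := by linarith
                               positivity
  have : 0 ≤ 1 - Real.cos t := by linarith [Real.cos_le_one t]
  positivity

lemma continuous_derivKernel {r : ℝ} (h0 : 0 ≤ r) (h1 : r < 1) : Continuous (derivKernel r) := by
  unfold derivKernel
  refine Continuous.div (by fun_prop) (by fun_prop) fun t => ?_
  exact pow_ne_zero _ (denom_pos h0 h1 t).ne'

lemma circ_re (t : ℝ) : (circ t).re = Real.cos t := Complex.exp_ofReal_mul_I_re t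
lemma circ_im (t : ℝ) : (circ t).im = Real.sin t := Complex.exp_ofReal_mul_I_im t

lemma circ_pow (t : ℝ) (n : ℕ) : circ t ^ n = circ (n * t) := by
  rw [circ, circ, ← Complex.exp_nat_mul]; push_cast; ring_nf

/-- Twice the imaginary part of `∑ n z ^ n = z / (1 - z) ^ 2` at `z = r e^{it}`. -/
lemma hasSum_derivKernel {r : ℝ} (h0 : 0 ≤ r) (h1 : r < 1) (t : ℝ) :
    HasSum (fun n : ℕ => 2 * (n * r ^ n * Real.sin (n * t))) (derivKernel r t) := by
  have hz : ‖(r : ℂ) * circ t‖ < 1 := by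
    simpa [norm_circ, abs_of_nonneg h0] using h1
  have h := (Complex.hasSum_im (hasSum_coe_mul_geometric_of_norm_lt_one hz)).mul_left 2
  convert! h using 1
  · ext n
    rw [mul_pow, circ_pow]
    have : (n : ℂ) * ((r : ℂ) ^ n * circ (n * t)) = ((n * r ^ n : ℝ) : ℂ) * circ (n * t) := by
      push_cast; ring
    rw [this, Complex.im_ofReal_mul, circ_im]
  · have hd := (denom_pos h0 h1 t).ne'
    have hn : Complex.normSq (1 - r * circ t) = 1 - 2 * r * Real.cos t + r ^ 2 := by
      rw [Complex.normSq_apply]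
      simp [circ_re, circ_im]
      nlinarith [Real.sin_sq_add_cos_sq t]
    rw [Complex.div_im, map_pow, hn, derivKernel]
    simp only [sq, Complex.mul_im, Complex.mul_re, Complex.sub_re, Complex.sub_im, Complex.one_re,
      Complex.one_im, Complex.ofReal_re, Complex.ofReal_im, circ_re, circ_im]
    field_simp
    have hs := Real.sin_sq_add_cos_sq t
    have hc : Real.cos t ^ 2 = 1 - Real.sin t ^ 2 := by linarith
    ring_nf
    rw [show Real.sin t ^ 3 = Real.sin t * (1 - Real.cos t ^ 2) by rw [hc]; ring]
    ring

lemma summable_coe_mul_pow {r : ℝ} (h0 : 0 ≤ r) (h1 : r < 1) :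
    Summable fun n : ℕ => (n : ℝ) * r ^ n := by
  refine (hasSum_coe_mul_geometric_of_norm_lt_one ?_).summable
  rwa [Real.norm_of_nonneg h0]

lemma hasSum_integral_derivKernel_smul {F : Type*} [NormedAddCommGroup F] [NormedSpace ℝ F]
    {r : ℝ} (h0 : 0 ≤ r) (h1 : r < 1) {h : ℝ → F} (hh : Continuous h) (a b : ℝ) :
    HasSum (fun n : ℕ => ∫ t in a..b, (2 * (n * r ^ n * Real.sin (n * t))) • h t)
      (∫ t in a..b, derivKernel r t • h t) := by
  have hs := summable_coe_mul_pow h0 h1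
  refine intervalIntegral.hasSum_integral_of_dominated_convergence
    (fun n t => (2 * (n * r ^ n)) * ‖h t‖) ?_ ?_ ?_ ?_ ?_
  · intro n
    exact Continuous.aestronglyMeasurable (by fun_prop)
  · intro n
    refine Eventually.of_forall fun t _ => ?_
    rw [norm_smul]
    gcongr
    rw [norm_mul, norm_mul, Real.norm_of_nonneg (by norm_num : (0 : ℝ) ≤ 2),
      Real.norm_of_nonneg (by positivity : 0 ≤ (n : ℝ) * r ^ n)]
    exact mul_le_mul_of_nonneg_left
      (mul_le_of_le_one_right (by positivity) (Real.abs_sin_le_one _)) (by norm_num)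
  · exact Eventually.of_forall fun t _ => (hs.mul_left 2).mul_right _
  · simp_rw [tsum_mul_right]
    exact (hh.norm.const_mul _).intervalIntegrable _ _
  · exact Eventually.of_forall fun t _ => (hasSum_derivKernel h0 h1 t).smul_const _

lemma integral_sin_mul_circ_pow (n m : ℕ) :
    ∫ t in (-Real.pi)..Real.pi, ((Real.sin (n * t) : ℝ) : ℂ) * circ t ^ m
      = if n = m then (if n = 0 then 0 else Real.pi * Complex.I) else 0 := by
  have h : ∀ t : ℝ, ((Real.sin (n * t) : ℝ) : ℂ) * circ t ^ m
      = (Complex.I / 2) * (circ t ^ ((m : ℤ) - n) - circ t ^ ((m : ℤ) + n)) := by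
    intro t
    have e : ((Real.sin (n * t) : ℝ) : ℂ)
        = (Complex.I / 2) * ((circ t ^ n)⁻¹ - circ t ^ n) := by
      rw [circ_pow, Complex.ofReal_sin, Complex.sin, circ, ← Complex.exp_neg]
      ring_nf
    have hz := circ_ne_zero t
    rw [e, zpow_sub₀ hz, zpow_add₀ hz, zpow_natCast, zpow_natCast]
    field_simp
  simp_rw [h]
  have hi : ∀ k : ℤ, IntervalIntegrable (fun t => circ t ^ k) volume (-Real.pi) Real.pi := by
    intro k
    refine Continuous.intervalIntegrable ?_ _ _
    simp_rw [circ_zpow]; fun_prop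
  have e2 : ∀ k : ℤ, ∫ t in (-Real.pi)..Real.pi, circ t ^ k
      = if k = 0 then (2 * Real.pi : ℂ) else 0 := by
    intro k
    rw [← integral_circ_zpow k (-Real.pi)]; congr 1; ring
  rw [intervalIntegral.integral_const_mul, intervalIntegral.integral_sub (hi _) (hi _), e2, e2]
  rcases eq_or_ne n m with rfl | hnm
  · rcases eq_or_ne n 0 with rfl | hn
    · simp
    · have : ((n : ℤ) + n) ≠ 0 := by positivity
      simp [hn]
      ring
  · have : ((m : ℤ) - n) ≠ 0 := by omega
    have h' : ((m : ℤ) + n) ≠ 0 := by omega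
    simp [this, h', hnm]

lemma integral_derivKernel_smul_circ_pow {r : ℝ} (h0 : 0 ≤ r) (h1 : r < 1) (m : ℕ) :
    ∫ t in (-Real.pi)..Real.pi, derivKernel r t • circ t ^ m
      = 2 * Real.pi * Complex.I * m * r ^ m := by
  have hS := hasSum_integral_derivKernel_smul h0 h1 (h := fun t => circ t ^ m) (by fun_prop)
    (-Real.pi) Real.pi
  refine hS.unique ?_
  have ht : ∀ n : ℕ, ∫ t in (-Real.pi)..Real.pi, (2 * (n * r ^ n * Real.sin (n * t))) • circ t ^ m
      = if n = m then (2 * Real.pi * Complex.I * m * r ^ m : ℂ) else 0 := by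
    intro n
    have : ∀ t : ℝ, (2 * (n * r ^ n * Real.sin (n * t))) • circ t ^ m
        = (2 * n * r ^ n : ℂ) * (((Real.sin (n * t) : ℝ) : ℂ) * circ t ^ m) := by
      intro t; rw [Complex.real_smul]; push_cast; ring
    simp_rw [this]
    rw [intervalIntegral.integral_const_mul, integral_sin_mul_circ_pow]
    rcases eq_or_ne n m with rfl | hnm
    · rcases eq_or_ne n 0 with rfl | hn
      · simp
      · simp [hn]; ring
    · simp [hnm]
  simp_rw [ht]
  exact hasSum_ite_eq m _

/-- Integrating the sine series against `t` turns it into a geometric series in `-r` without its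
term of index 0. The value tends to `2π` as `r → 1`, which is the normalization of the peak kernel.
-/
lemma integral_mul_derivKernel {r : ℝ} (h0 : 0 ≤ r) (h1 : r < 1) :
    ∫ t in (-Real.pi)..Real.pi, t * derivKernel r t = 4 * Real.pi * r / (1 + r) := by
  have hS := hasSum_integral_derivKernel_smul h0 h1 (h := fun t => t) continuous_id
    (-Real.pi) Real.pi
  have ht : ∀ n : ℕ, ∫ t in (-Real.pi)..Real.pi, (2 * (n * r ^ n * Real.sin (n * t))) • t
      = 4 * Real.pi * ((if n = 0 then 1 else 0) - (-r) ^ n) := by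
    intro n
    rcases eq_or_ne n 0 with rfl | hn
    · simp
    -- The primitive of `n t sin (n t)` found by integration by parts.
    have hd : ∀ t : ℝ, HasDerivAt (fun t : ℝ => -t * Real.cos (n * t) + Real.sin (n * t) / n)
        (n * t * Real.sin (n * t)) t := by
      intro t
      have hn' : (n : ℝ) ≠ 0 := by exact_mod_cast hn
      have h1 : HasDerivAt (fun t : ℝ => (n : ℝ) * t) n t := by
        simpa using (hasDerivAt_id t).const_mul (n : ℝ)
      have h2 := ((hasDerivAt_id t).neg.mul h1.cos).add (h1.sin.div_const (n : ℝ))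
      convert! h2 using 1
      simp
      field_simp
      ring
    have hI := intervalIntegral.integral_eq_sub_of_hasDerivAt (a := -Real.pi) (b := Real.pi)
      (fun t _ => hd t) ((by fun_prop : Continuous fun t : ℝ => n * t * Real.sin (n * t)
        ).intervalIntegrable _ _)
    have : ∀ t : ℝ, (2 * (n * r ^ n * Real.sin (n * t))) • t
        = (2 * r ^ n) * (n * t * Real.sin (n * t)) := by
      intro t; rw [smul_eq_mul]; ring
    simp_rw [this]
    rw [intervalIntegral.integral_const_mul, hI]
    have hcos : Real.cos (n * Real.pi) = (-1) ^ n := by simpa using Real.cos_nat_mul_pi n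
    have hsin : Real.sin (n * Real.pi) = 0 := Real.sin_nat_mul_pi n
    simp [mul_neg, Real.cos_neg, Real.sin_neg, hcos, hsin, hn]
    rw [show (-r) ^ n = (-1) ^ n * r ^ n by rw [← mul_pow]; simp]
    ring
  simp_rw [ht] at hS
  have hg : HasSum (fun n : ℕ => 4 * Real.pi * ((if n = 0 then (1 : ℝ) else 0) - (-r) ^ n))
      (4 * Real.pi * (1 - (1 - -r)⁻¹)) :=
    ((hasSum_ite_eq 0 (1 : ℝ)).sub (hasSum_geometric_of_abs_lt_one
      (by rwa [abs_neg, abs_of_nonneg h0]))).mul_left _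
  have := hS.unique hg
  have e : ∀ t, derivKernel r t • t = t * derivKernel r t := fun t => by
    rw [smul_eq_mul, mul_comm]
  simp_rw [e] at this
  rw [this]
  have : 1 + r ≠ 0 := by positivity
  have h' : 1 - -r ≠ 0 := by rwa [sub_neg_eq_add]
  field_simp
  ring

/-- The peak function in the proof of Fatou's theorem. -/
def peakKernel (r t : ℝ) : ℝ := (2 * Real.pi)⁻¹ * (t * derivKernel r t)

lemma peakKernel_nonneg {r : ℝ} (h0 : 0 ≤ r) (h1 : r < 1) {t : ℝ}
    (ht : t ∈ Set.Icc (-Real.pi) Real.pi) : 0 ≤ peakKernel r t := by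
  have hts : 0 ≤ t * Real.sin t := by
    rcases le_total 0 t with h | h
    · exact mul_nonneg h (Real.sin_nonneg_of_nonneg_of_le_pi h ht.2)
    · exact mul_nonneg_of_nonpos_of_nonpos h (Real.sin_nonpos_of_nonpos_of_neg_pi_le h ht.1)
  have h2 : 0 ≤ 1 - r ^ 2 := by nlinarith
  have : peakKernel r t = (2 * Real.pi)⁻¹ * (2 * r * (1 - r ^ 2) * (t * Real.sin t)
      / (1 - 2 * r * Real.cos t + r ^ 2) ^ 2) := by
    unfold peakKernel derivKernel; ring
  rw [this]
  positivity

lemma continuous_peakKernel {r : ℝ} (h0 : 0 ≤ r) (h1 : r < 1) : Continuous (peakKernel r) :=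
  (continuous_id.mul (continuous_derivKernel h0 h1)).const_mul _

lemma tendsto_integral_peakKernel :
    Tendsto (fun r => ∫ t in Set.Icc (-Real.pi) Real.pi, peakKernel r t) (𝓝[<] 1) (𝓝 1) := by
  have h : Tendsto (fun r : ℝ => (2 * Real.pi)⁻¹ * (4 * Real.pi * r / (1 + r))) (𝓝[<] 1)
      (𝓝 ((2 * Real.pi)⁻¹ * (4 * Real.pi * 1 / (1 + 1)))) := by
    refine Tendsto.mono_left ?_ nhdsWithin_le_nhds
    refine ContinuousAt.tendsto (f := fun r : ℝ => (2 * Real.pi)⁻¹ * (4 * Real.pi * r / (1 + r))) ?_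
    exact continuousAt_const.mul (ContinuousAt.div (by fun_prop) (by fun_prop) (by norm_num))
  have e : (2 * Real.pi)⁻¹ * (4 * Real.pi * 1 / (1 + 1)) = 1 := by
    have := Real.pi_ne_zero
    field_simp; norm_num
  rw [e] at h
  refine h.congr' ?_
  filter_upwards [Ioo_mem_nhdsLT (zero_lt_one' ℝ)] with r hr
  rw [integral_Icc_eq_integral_Ioc, ← intervalIntegral.integral_of_le (by linarith [Real.pi_pos])]
  unfold peakKernel
  rw [intervalIntegral.integral_const_mul, integral_mul_derivKernel hr.1.le hr.2]

/-- Away from 0 the denominator is bounded below, while the numerator carries the factor `1 - r ^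
2`, which tends to 0. -/
lemma tendstoUniformlyOn_peakKernel (u : Set ℝ) (hu : IsOpen u) (h0 : (0 : ℝ) ∈ u) :
    TendstoUniformlyOn peakKernel 0 (𝓝[<] 1) (Set.Icc (-Real.pi) Real.pi \ u) := by
  obtain ⟨δ, hδ, hδu⟩ := Metric.isOpen_iff.1 hu 0 h0
  -- The cap at `π` keeps `d` in the range where the cosine decreases.
  set d := min δ Real.pi with hd
  have hd0 : 0 < d := lt_min hδ Real.pi_pos
  have hdpi : d ≤ Real.pi := min_le_right _ _
  set c := 1 - Real.cos d with hc
  have hc0 : 0 < c := by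
    have : Real.cos d < Real.cos 0 := Real.cos_lt_cos_of_nonneg_of_le_pi le_rfl hdpi hd0
    rw [Real.cos_zero] at this; linarith
  have hb : ∀ r ∈ Set.Ioo (1 / 2 : ℝ) 1, ∀ t ∈ Set.Icc (-Real.pi) Real.pi \ u,
      |peakKernel r t| ≤ (1 - r ^ 2) / c ^ 2 := by
    intro r hr t ht
    have htd : d ≤ |t| := by
      by_contra! hlt
      refine ht.2 (hδu ?_)
      rw [mem_ball_zero_iff, Real.norm_eq_abs]
      exact hlt.trans_le (min_le_left _ _)
    have htpi : |t| ≤ Real.pi := abs_le.2 ht.1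
    have hcos : Real.cos t ≤ Real.cos d := by
      rw [← Real.cos_abs t]
      exact Real.cos_le_cos_of_nonneg_of_le_pi hd0.le htpi htd
    -- For `r > 1/2` the factor `2 * r` in `denom_eq` exceeds 1 and can be dropped.
    have hden : c ≤ 1 - 2 * r * Real.cos t + r ^ 2 := by
      rw [denom_eq]
      have : c ≤ 1 - Real.cos t := by rw [hc]; linarith
      nlinarith [sq_nonneg (1 - r), hr.1]
    have hr2 : 0 ≤ 1 - r ^ 2 := by nlinarith [hr.1, hr.2]
    have : peakKernel r t = (1 - r ^ 2) * (r * (t / Real.pi * Real.sin t))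
        / (1 - 2 * r * Real.cos t + r ^ 2) ^ 2 := by
      have := Real.pi_ne_zero
      unfold peakKernel derivKernel; field_simp
    rw [this, abs_div, abs_mul, abs_of_nonneg hr2,
      abs_of_nonneg (by positivity : 0 ≤ (1 - 2 * r * Real.cos t + r ^ 2) ^ 2)]
    have hq : |r * (t / Real.pi * Real.sin t)| ≤ 1 := by
      rw [abs_mul, abs_mul, abs_div, abs_of_pos Real.pi_pos, abs_of_pos (by linarith [hr.1] : 0 < r)]
      have h1 : |t| / Real.pi ≤ 1 := (div_le_one Real.pi_pos).2 htpi
      have h2 := Real.abs_sin_le_one t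
      have h3 : |t| / Real.pi * |Real.sin t| ≤ 1 :=
        mul_le_one₀ h1 (abs_nonneg _) h2
      exact mul_le_one₀ hr.2.le (by positivity) h3
    calc _ ≤ (1 - r ^ 2) * 1 / c ^ 2 := by gcongr
      _ = _ := by ring
  have hlim : Tendsto (fun r : ℝ => (1 - r ^ 2) / c ^ 2) (𝓝[<] 1) (𝓝 0) := by
    have : Continuous fun r : ℝ => (1 - r ^ 2) / c ^ 2 := by fun_prop
    have h := (this.tendsto 1).mono_left (nhdsWithin_le_nhds (s := Set.Iio 1))
    simpa using h
  rw [Metric.tendstoUniformlyOn_iff]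
  intro ε hε
  filter_upwards [hlim.eventually (gt_mem_nhds hε),
    Ioo_mem_nhdsLT (by norm_num : (1 / 2 : ℝ) < 1)] with r hr1 hr2 t ht
  rw [dist_comm, Pi.zero_apply, dist_zero_right]
  exact (hb r hr2 t ht).trans_lt hr1

/-! ### Square summable series, their primitives and Fatou's theorem -/

section

variable {E : Type*} [NormedAddCommGroup E] [InnerProductSpace ℂ E]

lemma eLpNorm_sum_circ (s : Finset ℕ) (a : ℕ → E) :
    eLpNorm (fun t => ∑ n ∈ s, circ t ^ n • a n) 2 (volume.restrict (Set.Ioc 0 (2 * Real.pi))) ^ 2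
      = ENNReal.ofReal (2 * Real.pi * ∑ n ∈ s, ‖a n‖ ^ 2) := by
  rw [eLpNorm_two_sq, lintegral_norm_sq_eq_ofReal
    (continuous_finsetSum _ fun n _ => continuous_circ_pow_smul n (a n)) _ _ (by positivity),
    integral_norm_sq_sum]

lemma memLp_sum_circ (s : Finset ℕ) (a : ℕ → E) :
    MemLp (fun t => ∑ n ∈ s, circ t ^ n • a n) 2 (volume.restrict (Set.Ioc 0 (2 * Real.pi))) := by
  refine ⟨(continuous_finsetSum _ fun n _ => continuous_circ_pow_smul n (a n)).aestronglyMeasurable,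
    ?_⟩
  have h := eLpNorm_sum_circ s a
  by_contra hne
  rw [not_lt, top_le_iff] at hne
  rw [hne] at h
  simp at h

/-- A trigonometric series with square summable coefficients converges in `L²`. -/
lemma exists_tendsto_eLpNorm_sum_circ [CompleteSpace E] {a : ℕ → E}
    (ha : Summable fun n => ‖a n‖ ^ 2) :
    ∃ g : ℝ → E, MemLp g 2 (volume.restrict (Set.Ioc 0 (2 * Real.pi))) ∧
      Tendsto (fun N => eLpNorm (fun t => ∑ n ∈ Finset.range N, circ t ^ n • a n - g t) 2
        (volume.restrict (Set.Ioc 0 (2 * Real.pi)))) atTop (𝓝 0) := by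
  set μ : Measure ℝ := volume.restrict (Set.Ioc 0 (2 * Real.pi)) with hμ
  let v : ℕ → Lp E 2 μ := fun N => (memLp_sum_circ (Finset.range N) a).toLp _
  -- By Parseval the distances between partial sums are those of the convergent series of squares,
  -- so completeness of `L²` supplies the limit.
  have hdist : ∀ M N, M ≤ N → ‖v N - v M‖ ^ 2
      = 2 * Real.pi * ∑ n ∈ Finset.Ico M N, ‖a n‖ ^ 2 := by
    intro M N hMN
    have e : v N - v M = (memLp_sum_circ (Finset.Ico M N) a).toLp _ := by
      rw [← MemLp.toLp_sub]
      congr 1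
      ext t
      simp only [Pi.sub_apply]
      rw [Finset.sum_Ico_eq_sub _ hMN]
    rw [e, Lp.norm_toLp, ← ENNReal.toReal_pow, eLpNorm_sum_circ, ENNReal.toReal_ofReal]
    positivity
  have hcau : CauchySeq v := by
    have h1 : CauchySeq fun N => 2 * Real.pi * ∑ n ∈ Finset.range N, ‖a n‖ ^ 2 :=
      ((ha.hasSum.tendsto_sum_nat).const_mul _).cauchySeq
    rw [Metric.cauchySeq_iff'] at h1 ⊢
    intro ε hε
    obtain ⟨N, hN⟩ := h1 (ε ^ 2) (by positivity)
    refine ⟨N, fun n hn => ?_⟩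
    have h2 := hN n hn
    rw [Real.dist_eq, ← mul_sub, ← Finset.sum_Ico_eq_sub _ hn, ← hdist N n hn] at h2
    rw [dist_eq_norm]
    exact lt_of_pow_lt_pow_left₀ 2 hε.le (lt_of_abs_lt h2)
  obtain ⟨G, hG⟩ := cauchySeq_tendsto_of_complete hcau
  refine ⟨G, Lp.memLp G, ?_⟩
  have := (Lp.tendsto_Lp_iff_tendsto_eLpNorm' v G).1 hG
  refine this.congr fun N => eLpNorm_congr_ae ?_
  filter_upwards [(memLp_sum_circ (Finset.range N) a).coeFn_toLp] with t ht
  simp [v, ht]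

lemma eLpNorm_sq_of_tendsto {a : ℕ → E} (ha : Summable fun n => ‖a n‖ ^ 2) {g : ℝ → E}
    (hg : MemLp g 2 (volume.restrict (Set.Ioc 0 (2 * Real.pi))))
    (h : Tendsto (fun N => eLpNorm (fun t => ∑ n ∈ Finset.range N, circ t ^ n • a n - g t) 2
        (volume.restrict (Set.Ioc 0 (2 * Real.pi)))) atTop (𝓝 0)) :
    ∫⁻ t in Set.Ioc 0 (2 * Real.pi), ‖g t‖ₑ ^ 2
      = ENNReal.ofReal (2 * Real.pi * ∑' n, ‖a n‖ ^ 2) := by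
  set μ : Measure ℝ := volume.restrict (Set.Ioc 0 (2 * Real.pi)) with hμ
  have hS := fun N => memLp_sum_circ (Finset.range N) a
  have h1 : Tendsto (fun N => eLpNorm (fun t => ∑ n ∈ Finset.range N, circ t ^ n • a n) 2 μ) atTop
      (𝓝 (eLpNorm g 2 μ)) := by
    have h' := (Lp.tendsto_Lp_iff_tendsto_eLpNorm'' (fun N t =>
      ∑ n ∈ Finset.range N, circ t ^ n • a n) hS g hg).2 h
    have h2 := h'.norm
    simp_rw [Lp.norm_toLp] at h2
    exact (ENNReal.tendsto_toReal_iff (fun N => (hS N).2.ne) hg.2.ne).1 h2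
  have h2 := ENNReal.Tendsto.pow (n := 2) h1
  simp_rw [hμ, eLpNorm_sum_circ] at h2
  rw [← eLpNorm_two_sq]
  exact tendsto_nhds_unique h2 (ENNReal.tendsto_ofReal ((ha.hasSum.tendsto_sum_nat).const_mul _))

/-- The coefficients of the primitive of a trigonometric series without constant term. -/
def primCoeff (a : ℕ → E) (n : ℕ) : E := ((n : ℂ) * Complex.I)⁻¹ • a n

/-- The primitive of a trigonometric series without its constant term. -/
def prim (a : ℕ → E) (t : ℝ) : E := ∑' n, circ t ^ n • primCoeff a n

/-- The product `n⁻¹ ‖a n‖` is at most the sum of the two squares, both summable. At `n = 0` the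
convention `0⁻¹ = 0` makes the coefficient vanish. -/
lemma summable_primCoeff {a : ℕ → E} (ha : Summable fun n => ‖a n‖ ^ 2) :
    Summable fun n => ‖primCoeff a n‖ := by
  have h2 : Summable fun n : ℕ => ((n : ℝ) ^ 2)⁻¹ := Real.summable_nat_pow_inv.2 (by norm_num)
  refine Summable.of_nonneg_of_le (fun n => norm_nonneg _) (fun n => ?_) (h2.add ha)
  rw [primCoeff, norm_smul, norm_inv, norm_mul, Complex.norm_I, mul_one, Complex.norm_natCast,
    ← inv_pow]
  nlinarith [sq_nonneg ((n : ℝ)⁻¹ - ‖a n‖), sq_nonneg ((n : ℝ)⁻¹), sq_nonneg (‖a n‖)]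

variable [CompleteSpace E]

lemma summable_prim {a : ℕ → E} (ha : Summable fun n => ‖a n‖ ^ 2) (t : ℝ) :
    Summable fun n => circ t ^ n • primCoeff a n :=
  Summable.of_norm_bounded (summable_primCoeff ha) fun n => (norm_circ_pow_smul t n _).le

lemma continuous_prim {a : ℕ → E} (ha : Summable fun n => ‖a n‖ ^ 2) : Continuous (prim a) :=
  continuous_tsum (fun n => continuous_circ_pow_smul n _) (summable_primCoeff ha)
    fun n t => (norm_circ_pow_smul t n _).le

lemma integral_circ_pow_smul {a : ℕ → E} {n : ℕ} (hn : n ≠ 0) (x : ℝ) :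
    ∫ t in (0 : ℝ)..x, circ t ^ n • a n = circ x ^ n • primCoeff a n - circ 0 ^ n • primCoeff a n := by
  rw [intervalIntegral.integral_smul_const]
  have hk : ((n : ℂ) * Complex.I) ≠ 0 := by simp [hn]
  have h : ∀ t, circ t ^ n = Complex.exp ((n * Complex.I) * t) := by
    intro t; simpa using circ_zpow t n
  simp_rw [h]
  rw [integral_exp_mul_complex hk, primCoeff, smul_smul, smul_smul, ← sub_smul]
  congr 1
  ring

/-- On a set of finite measure `L²` convergence implies `L¹` convergence, so the partial sums may be
integrated over `[0, x]` term by term. -/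
lemma prim_sub_prim_zero {a : ℕ → E} (ha : Summable fun n => ‖a n‖ ^ 2) {g : ℝ → E}
    (hg : MemLp g 2 (volume.restrict (Set.Ioc 0 (2 * Real.pi))))
    (h : Tendsto (fun N => eLpNorm (fun t => ∑ n ∈ Finset.range N, circ t ^ n • a n - g t) 2
        (volume.restrict (Set.Ioc 0 (2 * Real.pi)))) atTop (𝓝 0))
    {x : ℝ} (hx : x ∈ Set.Icc 0 (2 * Real.pi)) :
    prim a x - prim a 0 = ∫ t in (0 : ℝ)..x, (g t - a 0) := by
  set μ : Measure ℝ := volume.restrict (Set.Ioc 0 (2 * Real.pi)) with hμ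
  have hS := fun N => memLp_sum_circ (Finset.range N) a
  have hc : ∀ n, Continuous fun t => circ t ^ n • a n := fun n => continuous_circ_pow_smul n (a n)
  have hL1 : Tendsto (fun N => eLpNorm ((fun t => ∑ n ∈ Finset.range N, circ t ^ n • a n) - g) 1 μ)
      atTop (𝓝 0) := by
    have hm := ENNReal.Tendsto.mul_const h 
      (b := μ Set.univ ^ (1 / (1 : ℝ≥0∞).toReal - 1 / (2 : ℝ≥0∞).toReal))
      (Or.inr (ENNReal.rpow_ne_top_of_nonneg (by norm_num) (measure_ne_top _ _)))
    rw [zero_mul] at hm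
    refine tendsto_of_tendsto_of_tendsto_of_le_of_le tendsto_const_nhds hm (fun _ => zero_le) ?_
    intro N
    exact eLpNorm_le_eLpNorm_mul_rpow_measure_univ (by norm_num)
      ((hS N).1.sub hg.1)
  have h1 := tendsto_setIntegral_of_L1' g hg.1
    (Eventually.of_forall fun N => (hS N).integrable (by norm_num)) hL1 (Set.Ioc 0 x)
  have hsub : Set.Ioc 0 x ∩ Set.Ioc 0 (2 * Real.pi) = Set.Ioc 0 x :=
    Set.inter_eq_left.2 (Set.Ioc_subset_Ioc_right hx.2)
  simp_rw [hμ, Measure.restrict_restrict measurableSet_Ioc, hsub,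
    ← intervalIntegral.integral_of_le hx.1] at h1
  have hgi : IntervalIntegrable g volume 0 x := by
    rw [intervalIntegrable_iff_integrableOn_Ioc_of_le hx.1]
    have : IntegrableOn g (Set.Ioc 0 (2 * Real.pi)) := hg.integrable (by norm_num)
    exact this.mono_set (Set.Ioc_subset_Ioc_right hx.2)
  rw [intervalIntegral.integral_sub hgi intervalIntegrable_const]
  have h2 : Tendsto (fun N => ∑ n ∈ Finset.range N, (circ x ^ n • primCoeff a n
      - circ 0 ^ n • primCoeff a n)) atTop (𝓝 (prim a x - prim a 0)) :=
    ((summable_prim ha x).hasSum.sub (summable_prim ha 0).hasSum).tendsto_sum_nat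
  refine tendsto_nhds_unique h2 ?_
  have h3 := h1.sub_const (∫ _ in (0 : ℝ)..x, a 0)
  -- The index shift puts the term `n = 0` into every partial sum. Its integral cancels against that
  -- of `a 0`, and its primitive coefficient contributes nothing.
  refine (tendsto_add_atTop_iff_nat 1).1 (((tendsto_add_atTop_iff_nat 1).2 h3).congr fun N => ?_)
  rw [intervalIntegral.integral_finsetSum fun n _ => (hc n).intervalIntegrable _ _,
    Finset.sum_range_succ', Finset.sum_range_succ',
    Finset.sum_congr rfl fun n _ => integral_circ_pow_smul (a := a) n.succ_ne_zero x]
  simp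

/-- Lebesgue differentiation of the integral formula. The endpoint `2π` is discarded because the
formula is needed on a neighbourhood of the point. -/
lemma ae_hasDerivAt_prim {a : ℕ → E} (ha : Summable fun n => ‖a n‖ ^ 2) {g : ℝ → E}
    (hg : MemLp g 2 (volume.restrict (Set.Ioc 0 (2 * Real.pi))))
    (h : Tendsto (fun N => eLpNorm (fun t => ∑ n ∈ Finset.range N, circ t ^ n • a n - g t) 2
        (volume.restrict (Set.Ioc 0 (2 * Real.pi)))) atTop (𝓝 0)) :
    ∀ᵐ x ∂(volume.restrict (Set.Ioc 0 (2 * Real.pi))), HasDerivAt (prim a) (g x - a 0) x := by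
  have h2 : (0 : ℝ) ≤ 2 * Real.pi := by positivity
  have hgi : IntervalIntegrable (fun t => g t - a 0) volume 0 (2 * Real.pi) := by
    rw [intervalIntegrable_iff_integrableOn_Ioc_of_le h2]
    have : IntegrableOn g (Set.Ioc 0 (2 * Real.pi)) := hg.integrable (by norm_num)
    exact this.sub (integrable_const _)
  rw [ae_restrict_iff' measurableSet_Ioc]
  have hne : ∀ᵐ x : ℝ, x ≠ 2 * Real.pi := by simp [ae_iff, measure_singleton]
  filter_upwards [hgi.ae_hasDerivAt_integral, hne] with x hx hx2 hxI
  have hxo : x ∈ Set.Ioo 0 (2 * Real.pi) := ⟨hxI.1, lt_of_le_of_ne hxI.2 hx2⟩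
  have hd := hx (by rw [Set.uIcc_of_le h2]; exact Set.Ioc_subset_Icc_self hxI) 0
    (by rw [Set.uIcc_of_le h2]; exact ⟨le_rfl, h2⟩)
  have hd' := hd.add_const (prim a 0)
  refine hd'.congr_of_eventuallyEq ?_
  filter_upwards [Ioo_mem_nhds hxo.1 hxo.2] with y hy
  rw [← prim_sub_prim_zero ha hg h (Set.Ioo_subset_Icc_self hy)]
  simp

/-- Convolution with the kernel multiplies the frequency `n` by `2πi n r ^ n`. The factor `i n`
undoes the integration and kills the constant term, leaving the original series at radius `r`. -/
lemma integral_derivKernel_smul_prim {a : ℕ → E} (ha : Summable fun n => ‖a n‖ ^ 2) {r : ℝ}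
    (h0 : 0 ≤ r) (h1 : r < 1) (x : ℝ) :
    HasSum (fun n : ℕ => (2 * Real.pi) • if n = 0 then 0 else ((r : ℂ) * circ x) ^ n • a n)
      (∫ t in (-Real.pi)..Real.pi, derivKernel r t • prim a (x + t)) := by
  have hk := continuous_derivKernel h0 h1
  have hs := summable_primCoeff ha
  have hS : HasSum (fun n : ℕ => ∫ t in (-Real.pi)..Real.pi,
      derivKernel r t • (circ (x + t) ^ n • primCoeff a n))
      (∫ t in (-Real.pi)..Real.pi, derivKernel r t • prim a (x + t)) := by
    refine intervalIntegral.hasSum_integral_of_dominated_convergence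
      (fun n t => |derivKernel r t| * ‖primCoeff a n‖) ?_ ?_ ?_ ?_ ?_
    · intro n
      exact Continuous.aestronglyMeasurable (by fun_prop)
    · intro n
      refine Eventually.of_forall fun t _ => ?_
      rw [norm_smul, norm_circ_pow_smul, Real.norm_eq_abs]
    · exact Eventually.of_forall fun t _ => hs.mul_left _
    · simp_rw [tsum_mul_left]
      exact (hk.abs.mul continuous_const).intervalIntegrable _ _
    · exact Eventually.of_forall fun t _ => (summable_prim ha (x + t)).hasSum.const_smul _
  convert! hS using 1
  ext n
  have e : ∀ t, derivKernel r t • (circ (x + t) ^ n • primCoeff a n)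
      = (derivKernel r t • circ t ^ n) • (circ x ^ n • primCoeff a n) := by
    intro t
    rw [circ_add, mul_pow, smul_assoc, smul_smul (circ t ^ n), mul_comm]
  simp_rw [e]
  rw [intervalIntegral.integral_smul_const, integral_derivKernel_smul_circ_pow h0 h1]
  split_ifs with hn
  · simp [hn]
  · have hn' : (n : ℂ) ≠ 0 := by exact_mod_cast hn
    rw [primCoeff, smul_smul, smul_smul, ← Complex.coe_smul, smul_smul]
    congr 1
    have := Complex.I_ne_zero
    push_cast
    field_simp
    rw [mul_pow]

/-- The kernel has mean zero, so `prim a x` may be subtracted from `prim a (x + t)`. Dividing the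
difference by `t` and multiplying the kernel by `t` yields a difference quotient against the peak
kernel. -/
lemma hasSum_eq_peakKernel {a : ℕ → E} (ha : Summable fun n => ‖a n‖ ^ 2) {r : ℝ}
    (h0 : 0 ≤ r) (h1 : r < 1) (x : ℝ) :
    HasSum (fun n : ℕ => ((r : ℂ) * circ x) ^ n • a n)
      (a 0 + ∫ t in Set.Icc (-Real.pi) Real.pi, peakKernel r t • dslope (prim a) x (x + t)) := by
  have h := (integral_derivKernel_smul_prim ha h0 h1 x).const_smul ((2 * Real.pi)⁻¹ : ℝ)
  have hpi : (2 * Real.pi) ≠ 0 := by positivity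
  simp_rw [smul_smul, inv_mul_cancel₀ hpi, one_smul] at h
  have h' := (hasSum_ite_eq 0 (a 0)).add h
  convert! h' using 1
  · ext n
    rcases eq_or_ne n 0 with rfl | hn
    · simp
    · simp [hn]
  · congr 1
    rw [integral_Icc_eq_integral_Ioc,
      ← intervalIntegral.integral_of_le (by linarith [Real.pi_pos])]
    have e : ∀ t, peakKernel r t • dslope (prim a) x (x + t)
        = (2 * Real.pi)⁻¹ • (derivKernel r t • prim a (x + t) - derivKernel r t • prim a x) := by
      intro t
      rw [← smul_sub, ← sub_smul_dslope, add_sub_cancel_left, peakKernel, smul_smul, smul_smul]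
      ring_nf
    simp_rw [e]
    have hk := continuous_derivKernel h0 h1
    have hp := continuous_prim ha
    have hi1 : Continuous fun t => derivKernel r t • prim a (x + t) := by fun_prop
    have hi2 : Continuous fun t => derivKernel r t • prim a x := by fun_prop
    rw [intervalIntegral.integral_smul, intervalIntegral.integral_sub
      (hi1.intervalIntegrable _ _) (hi2.intervalIntegrable _ _)]
    -- The vanishing mean of the kernel is the case of exponent 0 of the orthogonality relation.
    have hz : ∫ t in (-Real.pi)..Real.pi, derivKernel r t • prim a x = 0 := by
      rw [intervalIntegral.integral_smul_const]
      have := integral_derivKernel_smul_circ_pow h0 h1 0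
      simp only [pow_zero, Nat.cast_zero, mul_zero, mul_one] at this
      have h2 : ∫ t in (-Real.pi)..Real.pi, ((derivKernel r t : ℝ) : ℂ) = 0 := by
        simpa using this
      rw [intervalIntegral.integral_ofReal] at h2
      rw [Complex.ofReal_eq_zero.1 h2, zero_smul]
    rw [hz, sub_zero]

/-- Fatou's theorem at the points where the primitive is differentiable. -/
lemma tendsto_radial_of_hasDerivAt {a : ℕ → E} (ha : Summable fun n => ‖a n‖ ^ 2) {x : ℝ} {d : E}
    (hd : HasDerivAt (prim a) d x) :
    Tendsto (fun r : ℝ => ∑' n : ℕ, ((r : ℂ) * circ x) ^ n • a n) (𝓝[<] 1) (𝓝 (a 0 + d)) := by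
  have hc : Continuous fun t => dslope (prim a) x (x + t) := by
    have : Continuous (dslope (prim a) x) := by
      rw [← continuousOn_univ, continuousOn_dslope univ_mem]
      exact ⟨(continuous_prim ha).continuousOn, hd.differentiableAt⟩
    fun_prop
  have h := tendsto_setIntegral_peak_smul_of_integrableOn_of_tendsto (μ := volume)
    (g := fun t => dslope (prim a) x (x + t)) (l := 𝓝[<] (1 : ℝ)) (x₀ := 0)
    (s := Set.Icc (-Real.pi) Real.pi) (φ := peakKernel) (a := d)
    measurableSet_Icc measurableSet_Icc subset_rfl self_mem_nhdsWithin
    (by simp)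
    (by filter_upwards [Ioo_mem_nhdsLT (zero_lt_one' ℝ)] with r hr t ht
          using peakKernel_nonneg hr.1.le hr.2 ht)
    tendstoUniformlyOn_peakKernel tendsto_integral_peakKernel
    (by filter_upwards [Ioo_mem_nhdsLT (zero_lt_one' ℝ)] with r hr
          using (continuous_peakKernel hr.1.le hr.2).aestronglyMeasurable)
    hc.continuousOn.integrableOn_Icc
    (by
      have := hc.tendsto 0
      simp only [add_zero, dslope_same, hd.deriv] at this
      exact this.mono_left nhdsWithin_le_nhds)
  refine (h.const_add (a 0)).congr' ?_
  filter_upwards [Ioo_mem_nhdsLT (zero_lt_one' ℝ)] with r hr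
  exact (hasSum_eq_peakKernel ha hr.1.le hr.2 x).tsum_eq.symm

/-- Fatou's theorem for power series with square summable coefficients in a Hilbert space. -/
theorem exists_radial_limit {a : ℕ → E} (ha : Summable fun n => ‖a n‖ ^ 2) :
    ∃ g : ℝ → E,
      (∀ᵐ x ∂(volume.restrict (Set.Ioc 0 (2 * Real.pi))),
        Tendsto (fun r : ℝ => ∑' n : ℕ, ((r : ℂ) * circ x) ^ n • a n) (𝓝[<] 1) (𝓝 (g x))) ∧
      ∫⁻ t in Set.Ioc 0 (2 * Real.pi), ‖g t‖ₑ ^ 2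
        = ENNReal.ofReal (2 * Real.pi * ∑' n, ‖a n‖ ^ 2) := by
  obtain ⟨g, hg, h⟩ := exists_tendsto_eLpNorm_sum_circ ha
  refine ⟨g, ?_, eLpNorm_sq_of_tendsto ha hg h⟩
  filter_upwards [ae_hasDerivAt_prim ha hg h] with x hx
  simpa using tendsto_radial_of_hasDerivAt ha hx

end

/-! ### Slices of the quaternions and the representation formula -/

lemma mul_self_of_mem_imUnits {i : ℍ[ℝ]} (hi : i ∈ imUnits) : i * i = -1 := by
  obtain ⟨h0, h1⟩ := hi
  have h2 : Quaternion.normSq i = 1 := by rw [Quaternion.normSq_eq_norm_mul_self, h1, one_mul]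
  rw [Quaternion.normSq_def'] at h2
  ext <;> simp [h0] at * <;> nlinarith

/-- The embedding of the complex plane as the slice determined by `i`. -/
def sliceHom {i : ℍ[ℝ]} (hi : i ∈ imUnits) : ℂ →ₐ[ℝ] ℍ[ℝ] :=
  Complex.lift ⟨i, mul_self_of_mem_imUnits hi⟩

lemma sliceHom_apply {i : ℍ[ℝ]} (hi : i ∈ imUnits) (z : ℂ) :
    sliceHom hi z = z.re • (1 : ℍ[ℝ]) + z.im • i := by
  simp [sliceHom, Complex.liftAux_apply, Algebra.algebraMap_eq_smul_one]

lemma slicePoint_eq (i : ℍ[ℝ]) (x y : ℝ) : slicePoint i x y = x • (1 : ℍ[ℝ]) + y • i := by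
  rw [slicePoint]
  ext <;> simp [mul_comm]

lemma slicePoint_eq_sliceHom {i : ℍ[ℝ]} (hi : i ∈ imUnits) (x y : ℝ) :
    slicePoint i x y = sliceHom hi ⟨x, y⟩ := by
  rw [slicePoint_eq, sliceHom_apply]

lemma sliceHom_eq_slicePoint {i : ℍ[ℝ]} (hi : i ∈ imUnits) (z : ℂ) :
    sliceHom hi z = slicePoint i z.re z.im := by
  rw [slicePoint_eq, sliceHom_apply]

lemma norm_sliceHom {i : ℍ[ℝ]} (hi : i ∈ imUnits) (z : ℂ) : ‖sliceHom hi z‖ = ‖z‖ := by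
  have h2 : Quaternion.normSq i = 1 := by
    rw [Quaternion.normSq_eq_norm_mul_self, hi.2, one_mul]
  rw [Quaternion.normSq_def'] at h2
  have h3 : ‖sliceHom hi z‖ ^ 2 = ‖z‖ ^ 2 := by
    rw [sq, ← Quaternion.normSq_eq_norm_mul_self, ← Complex.normSq_eq_norm_sq,
      Quaternion.normSq_def', Complex.normSq_apply, sliceHom_apply]
    have := hi.1
    simp [this] at h2 ⊢
    linear_combination z.im ^ 2 * h2
  exact (pow_left_inj₀ (norm_nonneg _) (norm_nonneg _) two_ne_zero).1 h3

lemma sliceHom_mem_unitBall {i : ℍ[ℝ]} (hi : i ∈ imUnits) {z : ℂ} :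
    sliceHom hi z ∈ unitBall ↔ ‖z‖ < 1 := by
  rw [mem_ball_zero_iff, norm_sliceHom]

lemma polarPoint_eq {i : ℍ[ℝ]} (hi : i ∈ imUnits) (r θ : ℝ) :
    polarPoint i r θ = sliceHom hi (r * circ θ) := by
  rw [polarPoint, sliceHom_eq_slicePoint]
  simp [circ_re, circ_im]

lemma norm_real_mul_circ {r : ℝ} (h0 : 0 ≤ r) (θ : ℝ) : ‖(r : ℂ) * circ θ‖ = r := by
  simp [norm_circ, abs_of_nonneg h0]

lemma polarPoint_mem {i : ℍ[ℝ]} (hi : i ∈ imUnits) {r : ℝ} (h0 : 0 ≤ r) (h1 : r < 1) (θ : ℝ) :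
    polarPoint i r θ ∈ unitBall := by
  rw [polarPoint_eq hi, sliceHom_mem_unitBall, norm_real_mul_circ h0]
  exact h1

lemma exists_mem_imUnits : ∃ i, i ∈ imUnits := by
  let u : ℍ[ℝ] := ⟨0, 1, 0, 0⟩
  have h : ‖u‖ * ‖u‖ = 1 := by
    rw [← Quaternion.normSq_eq_norm_mul_self, Quaternion.normSq_def']
    simp [u]
  exact ⟨u, rfl, by nlinarith [norm_nonneg u]⟩

/-- The normalized imaginary part is the unit of the slice; a real quaternion lies on every slice.
-/
lemma exists_eq_sliceHom (x : ℍ[ℝ]) : ∃ (i : ℍ[ℝ]) (hi : i ∈ imUnits) (z : ℂ), x = sliceHom hi z := by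
  by_cases h : x.im = 0
  · obtain ⟨i, hi⟩ := exists_mem_imUnits
    refine ⟨i, hi, x.re, ?_⟩
    rw [sliceHom_apply]
    nth_rewrite 1 [← Quaternion.re_add_im x]
    rw [h]
    ext <;> simp
  · have hn : ‖x.im‖ ≠ 0 := norm_ne_zero_iff.2 h
    have hu : ‖x.im‖⁻¹ • x.im ∈ imUnits := ⟨by simp, by rw [norm_smul]; simp [hn]⟩
    refine ⟨‖x.im‖⁻¹ • x.im, hu, ⟨x.re, ‖x.im‖⟩, ?_⟩
    rw [sliceHom_apply hu, smul_smul]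
    simp only
    rw [mul_inv_cancel₀ hn, one_smul]
    nth_rewrite 1 [← Quaternion.re_add_im x]
    congr 1
    ext <;> simp

/-- The coefficient of the value at `x + iy` in the representation formula. -/
def repLeft (i j : ℍ[ℝ]) : ℍ[ℝ] := (2⁻¹ : ℝ) • (1 - j * i)

/-- The coefficient of the value at `x - iy` in the representation formula. -/
def repRight (i j : ℍ[ℝ]) : ℍ[ℝ] := (2⁻¹ : ℝ) • (1 + j * i)

lemma norm_repLeft_le {i j : ℍ[ℝ]} (hi : i ∈ imUnits) (hj : j ∈ imUnits) : ‖repLeft i j‖ ≤ 1 := by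
  have h : ‖1 - j * i‖ ≤ 1 + 1 := (norm_sub_le _ _).trans (by rw [norm_mul, hi.2, hj.2]; simp)
  rw [repLeft, norm_smul, Real.norm_of_nonneg (by norm_num)]
  linarith

lemma norm_repRight_le {i j : ℍ[ℝ]} (hi : i ∈ imUnits) (hj : j ∈ imUnits) : ‖repRight i j‖ ≤ 1 := by
  have h : ‖1 + j * i‖ ≤ 1 + 1 := (norm_add_le _ _).trans (by rw [norm_mul, hi.2, hj.2]; simp)
  rw [repRight, norm_smul, Real.norm_of_nonneg (by norm_num)]
  linarith

lemma rep_formula {i : ℍ[ℝ]} (hi : i ∈ imUnits) (j a b : ℍ[ℝ]) :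
    repLeft i j * (a + i * b) + repRight i j * (a - i * b) = a + j * b := by
  have h := mul_self_of_mem_imUnits hi
  have e : repLeft i j * (a + i * b) + repRight i j * (a - i * b)
      = (2⁻¹ : ℝ) • ((a - j * (i * i) * b) + (a - j * (i * i) * b)) := by
    simp only [repLeft, repRight, smul_mul_assoc, ← smul_add]
    congr 1
    noncomm_ring
  rw [e, h, ← two_smul ℝ, smul_smul]
  simp

/-- The representation formula for the identity function. Applied to powers of `z` it transfers a
power series from one slice to another. -/
lemma sliceHom_rep {i j : ℍ[ℝ]} (hi : i ∈ imUnits) (hj : j ∈ imUnits) (z : ℂ) :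
    sliceHom hj z = repLeft i j * sliceHom hi z
      + repRight i j * sliceHom hi ((starRingEnd ℂ) z) := by
  have h := rep_formula hi j (z.re • 1) (z.im • 1)
  simp only [mul_smul_comm, mul_one] at h
  rw [sliceHom_apply hj, sliceHom_apply hi, sliceHom_apply hi, ← h]
  simp [sub_eq_add_neg]

/-! ### The complex Hilbert space structure attached to a slice -/

/-- Left multiplication by the slice determined by `i` makes the quaternions a complex normed
space. -/
@[reducible]
def sliceNormedSpace {i : ℍ[ℝ]} (hi : i ∈ imUnits) : NormedSpace ℂ ℍ[ℝ] where
  smul z q := sliceHom hi z * q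
  one_smul q := by change sliceHom hi 1 * q = q; simp
  mul_smul z w q := by
    change sliceHom hi (z * w) * q = sliceHom hi z * (sliceHom hi w * q)
    rw [map_mul, mul_assoc]
  smul_zero z := mul_zero _
  smul_add z p q := mul_add _ _ _
  add_smul z w q := by
    change sliceHom hi (z + w) * q = sliceHom hi z * q + sliceHom hi w * q
    rw [map_add, add_mul]
  zero_smul q := by change sliceHom hi 0 * q = 0; simp
  norm_smul_le z q := by
    change ‖sliceHom hi z * q‖ ≤ _
    rw [norm_mul, norm_sliceHom]

/-- The complex inner product on the quaternions for the complex structure of a slice. -/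
@[reducible]
def sliceInnerProductSpace {i : ℍ[ℝ]} (hi : i ∈ imUnits) : InnerProductSpace ℂ ℍ[ℝ] :=
  letI := sliceNormedSpace hi
  -- Jordan and von Neumann: the parallelogram law involves only the norm, which is the usual one
  -- whatever the complex structure.
  InnerProductSpace.ofNorm ℂ fun x y => by
    simpa only [sq] using parallelogram_law_with_norm ℝ x y

/-- Fatou's theorem on a slice. -/
lemma exists_radial_limit_slice {i : ℍ[ℝ]} (hi : i ∈ imUnits) {a : ℕ → ℍ[ℝ]}
    (ha : Summable fun n => ‖a n‖ ^ 2) :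
    ∃ g : ℝ → ℍ[ℝ],
      (∀ᵐ x ∂(volume.restrict (Set.Ioc 0 (2 * Real.pi))),
        Tendsto (fun r : ℝ => ∑' n : ℕ, polarPoint i r x ^ n * a n) (𝓝[<] 1) (𝓝 (g x))) ∧
      ∫⁻ t in Set.Ioc 0 (2 * Real.pi), ‖g t‖ₑ ^ 2
        = ENNReal.ofReal (2 * Real.pi * ∑' n, ‖a n‖ ^ 2) := by
  let _ := sliceInnerProductSpace hi
  obtain ⟨g, h1, h2⟩ := exists_radial_limit ha
  refine ⟨g, ?_, h2⟩
  filter_upwards [h1] with x hx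
  refine hx.congr fun r => tsum_congr fun n => ?_
  change sliceHom hi _ * _ = _
  rw [map_pow, polarPoint_eq hi]

/-- Parseval's identity on a slice. -/
lemma lintegral_norm_sq_tsum_slice {i : ℍ[ℝ]} (hi : i ∈ imUnits) {c : ℕ → ℍ[ℝ]}
    (hc : Summable fun n => ‖c n‖) :
    ∫⁻ t in Set.Ioc 0 (2 * Real.pi), ‖∑' n, sliceHom hi (circ t) ^ n * c n‖ₑ ^ 2
      = ENNReal.ofReal (2 * Real.pi * ∑' n, ‖c n‖ ^ 2) := by
  let _ := sliceInnerProductSpace hi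
  rw [← lintegral_norm_sq_tsum hc]
  refine lintegral_congr fun t => ?_
  congr 3
  ext1 n
  change _ = sliceHom hi _ * _
  rw [map_pow]

/-- The slice embedding as a continuous linear map. -/
def sliceCLM {i : ℍ[ℝ]} (hi : i ∈ imUnits) : ℂ →L[ℝ] ℍ[ℝ] :=
  LinearMap.toContinuousLinearMap (sliceHom hi).toLinearMap

lemma sliceCLM_apply {i : ℍ[ℝ]} (hi : i ∈ imUnits) (z : ℂ) : sliceCLM hi z = sliceHom hi z := rfl

/-- Multiplication of the slice embedding by a quaternion from the right. -/
def sliceMulCLM {i : ℍ[ℝ]} (hi : i ∈ imUnits) (d : ℍ[ℝ]) : ℂ →L[ℝ] ℍ[ℝ] :=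
  ((ContinuousLinearMap.mul ℝ ℍ[ℝ]).flip d).comp (sliceCLM hi)

lemma sliceMulCLM_apply {i : ℍ[ℝ]} (hi : i ∈ imUnits) (d : ℍ[ℝ]) (z : ℂ) :
    sliceMulCLM hi d z = sliceHom hi z * d := rfl

/-- Complex differentiability for the complex structure of a slice in terms of real
differentiability. -/
lemma hasDerivAt_slice_iff {i : ℍ[ℝ]} (hi : i ∈ imUnits) {F : ℂ → ℍ[ℝ]} {d : ℍ[ℝ]} {z : ℂ} :
    (letI := sliceNormedSpace hi; HasDerivAt F d z) ↔ HasFDerivAt F (sliceMulCLM hi d) z := by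
  let _ := sliceNormedSpace hi
  change HasDerivAt F d z ↔ _
  rw [hasDerivAt_iff_isLittleO, hasFDerivAt_iff_isLittleO]
  rfl

lemma hasDerivAt_slicePoint_left (i : ℍ[ℝ]) (x y : ℝ) :
    HasDerivAt (fun t => slicePoint i t y) 1 x := by
  simp_rw [slicePoint_eq]
  simpa using ((hasDerivAt_id x).smul_const (1 : ℍ[ℝ])).add_const (y • i)

lemma hasDerivAt_slicePoint_right (i : ℍ[ℝ]) (x y : ℝ) :
    HasDerivAt (fun t => slicePoint i x t) i y := by
  simp_rw [slicePoint_eq]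
  simpa using ((hasDerivAt_id y).smul_const i).const_add (x • (1 : ℍ[ℝ]))

/-! ### Slice hyperholomorphic functions and power series -/

/-- The restriction of a slice hyperholomorphic function to a slice is holomorphic. -/
lemma hasFDerivAt_slice {f : ℍ[ℝ] → ℍ[ℝ]} (hf : IsSliceHyperholomorphicOn unitBall f)
    {i : ℍ[ℝ]} (hi : i ∈ imUnits) {z : ℂ} (hz : ‖z‖ < 1) :
    ∃ d, HasFDerivAt (fun w => f (sliceHom hi w)) (sliceMulCLM hi d) z := by
  obtain ⟨hd, α, β, h⟩ := hf
  have hzU : sliceHom hi z ∈ unitBall := (sliceHom_mem_unitBall hi).2 hz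
  rw [sliceHom_eq_slicePoint] at hzU
  have hU : unitBall ∈ 𝓝 (slicePoint i z.re z.im) := Metric.isOpen_ball.mem_nhds hzU
  obtain ⟨-, -, -, a, b, h1, h2, h3, h4⟩ := h i hi z.re z.im hzU
  have hL := (hd.differentiableAt hU).hasFDerivAt
  set L := fderiv ℝ f (slicePoint i z.re z.im) with hLdef
  have hx1 := hL.comp_hasDerivAt z.re (hasDerivAt_slicePoint_left i z.re z.im)
  have hx2 : HasDerivAt (fun t => α t z.im + i * β t z.im) (a + i * b) z.re :=
    h1.add (h3.const_mul i)
  have hx3 : HasDerivAt (fun t => α t z.im + i * β t z.im) (L 1) z.re := by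
    refine hx1.congr_of_eventuallyEq ?_
    filter_upwards [(hasDerivAt_slicePoint_left i z.re z.im).continuousAt hU] with t ht
    exact (h i hi t z.im ht).1.symm
  have ex := hx3.unique hx2
  have hy1 := hL.comp_hasDerivAt z.im (hasDerivAt_slicePoint_right i z.re z.im)
  have hy2 : HasDerivAt (fun t => α z.re t + i * β z.re t) (-b + i * a) z.im :=
    h4.add (h2.const_mul i)
  have hy3 : HasDerivAt (fun t => α z.re t + i * β z.re t) (L i) z.im := by
    refine hy1.congr_of_eventuallyEq ?_
    filter_upwards [(hasDerivAt_slicePoint_right i z.re z.im).continuousAt hU] with t ht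
    exact (h i hi z.re t ht).1.symm
  have ey := hy3.unique hy2
  -- The Cauchy-Riemann system gives `L 1 = a + i * b` and `L i = -b + i * a = i * L 1`, so the real
  -- differential is complex linear along the slice.
  refine ⟨a + i * b, ?_⟩
  have hcomp : HasFDerivAt (fun w => f (sliceHom hi w)) (L.comp (sliceCLM hi)) z := by
    rw [← sliceHom_eq_slicePoint hi] at hL
    exact hL.comp z (sliceCLM hi).hasFDerivAt
  convert! hcomp using 1
  refine ContinuousLinearMap.ext fun w => ?_
  rw [ContinuousLinearMap.comp_apply, sliceMulCLM_apply, sliceCLM_apply, sliceHom_apply, map_add,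
    map_smul, map_smul, ex, ey, add_mul, smul_mul_assoc, smul_mul_assoc, one_mul, mul_add,
    ← mul_assoc, mul_self_of_mem_imUnits hi, neg_one_mul, add_comm (-b)]

/-- A slice hyperholomorphic function on the unit ball is a power series. -/
theorem exists_hasSum_of_isSliceHyperholomorphicOn {f : ℍ[ℝ] → ℍ[ℝ]}
    (hf : IsSliceHyperholomorphicOn unitBall f) :
    ∃ a : ℕ → ℍ[ℝ], ∀ x ∈ unitBall, HasSum (fun n => x ^ n * a n) (f x) := by
  obtain ⟨i, hi⟩ := exists_mem_imUnits
  have hi' : ∃ a : ℕ → ℍ[ℝ], ∀ z : ℂ, ‖z‖ < 1 →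
      HasSum (fun n => sliceHom hi z ^ n * a n) (f (sliceHom hi z)) := by
    let _ := sliceNormedSpace hi
    have hd : DifferentiableOn ℂ (fun w => f (sliceHom hi w)) (Metric.ball 0 1) := by
      intro z hz
      obtain ⟨d, hd⟩ := hasFDerivAt_slice hf hi (mem_ball_zero_iff.1 hz)
      exact ((hasDerivAt_slice_iff hi).2 hd).differentiableAt.differentiableWithinAt
    refine ⟨fun n => ((n.factorial : ℂ))⁻¹ • iteratedDeriv n (fun w => f (sliceHom hi w)) 0,
      fun z hz => ?_⟩
    have h := Complex.hasSum_taylorSeries_on_ball hd (mem_ball_zero_iff.2 hz)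
    convert! h using 2 with n
    rw [sub_zero, smul_comm, ← map_pow]
    rfl
  obtain ⟨a, ha⟩ := hi'
  -- The coefficients found on one slice serve on all others: both the function and the powers obey
  -- the representation formula.
  refine ⟨a, fun x hx => ?_⟩
  obtain ⟨j, hj, z, rfl⟩ := exists_eq_sliceHom x
  have hz := (sliceHom_mem_unitBall hj).1 hx
  have hz' : ‖(starRingEnd ℂ) z‖ < 1 := by rwa [RCLike.norm_conj]
  have h := ((ha z hz).mul_left (repLeft i j)).add ((ha _ hz').mul_left (repRight i j))
  convert! h using 1
  · ext1 n
    rw [← map_pow, sliceHom_rep hi hj, add_mul, map_pow, map_pow, map_pow, mul_assoc, mul_assoc]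
  · obtain ⟨-, α, β, H⟩ := hf
    rw [sliceHom_eq_slicePoint] at hx
    have hx' : sliceHom hi z ∈ unitBall := (sliceHom_mem_unitBall hi).2 hz
    have hx'' : sliceHom hi ((starRingEnd ℂ) z) ∈ unitBall := (sliceHom_mem_unitBall hi).2 hz'
    rw [sliceHom_eq_slicePoint] at hx' hx''
    rw [sliceHom_eq_slicePoint, sliceHom_eq_slicePoint, sliceHom_eq_slicePoint,
      (H j hj _ _ hx).1, (H i hi _ _ hx').1, (H i hi _ _ hx'').1, Complex.conj_re, Complex.conj_im,
      (H i hi _ _ hx').2.1, (H i hi _ _ hx').2.2.1, mul_neg, ← sub_eq_add_neg, rep_formula hi]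

/-- The maps `x ↦ x ^ n * a n` come from real multilinear maps of norm at most `‖a n‖`, so bounded
coefficients give radius of convergence at least 1. -/
lemma differentiableOn_of_hasSum {f : ℍ[ℝ] → ℍ[ℝ]} {a : ℕ → ℍ[ℝ]} {C : ℝ} (hC : ∀ n, ‖a n‖ ≤ C)
    (hf : ∀ x ∈ unitBall, HasSum (fun n => x ^ n * a n) (f x)) :
    DifferentiableOn ℝ f unitBall := by
  let p : FormalMultilinearSeries ℝ ℍ[ℝ] ℍ[ℝ] := fun n =>
    ((ContinuousLinearMap.mul ℝ ℍ[ℝ]).flip (a n)).compContinuousMultilinearMap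
      (ContinuousMultilinearMap.mkPiAlgebraFin ℝ n ℍ[ℝ])
  have hpn : ∀ n, ‖p n‖ ≤ ‖a n‖ := by
    intro n
    refine (ContinuousLinearMap.norm_compContinuousMultilinearMap_le _ _).trans ?_
    rw [ContinuousMultilinearMap.norm_mkPiAlgebraFin, mul_one]
    refine ContinuousLinearMap.opNorm_le_bound _ (norm_nonneg _) fun x => ?_
    simp [mul_comm]
  have hr : 1 ≤ p.radius := by
    have := p.le_radius_of_bound (r := 1) C fun n => by simpa using (hpn n).trans (hC n)
    simpa using this
  have hp := (p.hasFPowerSeriesOnBall (one_pos.trans_le hr)).differentiableOn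
  have hsub : unitBall ⊆ Metric.eball 0 p.radius := by
    intro x hx
    rw [unitBall, ← Metric.eball_ofReal] at hx
    exact Metric.eball_subset_eball (by simpa using hr) hx
  refine (hp.mono hsub).congr fun x hx => ?_
  rw [← (hf x hx).tsum_eq, FormalMultilinearSeries.sum]
  refine tsum_congr fun n => ?_
  simp [p]

lemma differentiableOn_tsum_pow_smul {E : Type*} [NormedAddCommGroup E] [NormedSpace ℂ E]
    [CompleteSpace E] {a : ℕ → E} {C : ℝ} (hC : ∀ n, ‖a n‖ ≤ C) :
    DifferentiableOn ℂ (fun z : ℂ => ∑' n, z ^ n • a n) (Metric.ball 0 1) := by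
  let p : FormalMultilinearSeries ℂ ℂ E := fun n =>
    ContinuousMultilinearMap.mkPiRing ℂ (Fin n) (a n)
  have hr : 1 ≤ p.radius := by
    have := p.le_radius_of_bound (r := 1) C fun n => by
      simpa [p, ContinuousMultilinearMap.norm_mkPiRing] using hC n
    simpa using this
  have hp := (p.hasFPowerSeriesOnBall (one_pos.trans_le hr)).differentiableOn
  have hsub : Metric.ball (0 : ℂ) 1 ⊆ Metric.eball 0 p.radius := by
    intro x hx
    rw [← Metric.eball_ofReal] at hx
    exact Metric.eball_subset_eball (by simpa using hr) hx
  refine (hp.mono hsub).congr fun x hx => ?_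
  rw [FormalMultilinearSeries.sum]
  refine tsum_congr fun n => ?_
  simp [p]

/-- The representation formula for power series. -/
lemma eq_rep_of_hasSum {f : ℍ[ℝ] → ℍ[ℝ]} {a : ℕ → ℍ[ℝ]}
    (hf : ∀ x ∈ unitBall, HasSum (fun n => x ^ n * a n) (f x)) {i j : ℍ[ℝ]} (hi : i ∈ imUnits)
    (hj : j ∈ imUnits) {z : ℂ} (hz : ‖z‖ < 1) :
    f (sliceHom hj z) = repLeft i j * f (sliceHom hi z)
      + repRight i j * f (sliceHom hi ((starRingEnd ℂ) z)) := by
  have hz' : ‖(starRingEnd ℂ) z‖ < 1 := by rwa [RCLike.norm_conj]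
  have h1 := hf _ ((sliceHom_mem_unitBall hj).2 hz)
  have h2 := hf _ ((sliceHom_mem_unitBall hi).2 hz)
  have h3 := hf _ ((sliceHom_mem_unitBall hi).2 hz')
  refine h1.unique ?_
  convert! (h2.mul_left (repLeft i j)).add (h3.mul_left (repRight i j)) using 1
  ext1 n
  rw [← map_pow, sliceHom_rep hi hj, add_mul, map_pow, map_pow, map_pow, mul_assoc, mul_assoc]

/-- A power series with bounded coefficients is slice hyperholomorphic on the unit ball. -/
theorem isSliceHyperholomorphicOn_of_hasSum {f : ℍ[ℝ] → ℍ[ℝ]} {a : ℕ → ℍ[ℝ]} {C : ℝ}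
    (hC : ∀ n, ‖a n‖ ≤ C) (hf : ∀ x ∈ unitBall, HasSum (fun n => x ^ n * a n) (f x)) :
    IsSliceHyperholomorphicOn unitBall f := by
  refine ⟨differentiableOn_of_hasSum hC hf, ?_⟩
  obtain ⟨i, hi⟩ := exists_mem_imUnits
  set F : ℂ → ℍ[ℝ] := fun z => f (sliceHom hi z) with hF
  have hFd : ∀ z : ℂ, ‖z‖ < 1 → ∃ d, HasFDerivAt F (sliceMulCLM hi d) z := by
    intro z hz
    let _ := sliceNormedSpace hi
    have hd := differentiableOn_tsum_pow_smul hC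
    have hd' : DifferentiableOn ℂ F (Metric.ball 0 1) := by
      refine hd.congr fun w hw => ?_
      rw [mem_ball_zero_iff] at hw
      rw [hF]
      simp only
      rw [← (hf _ ((sliceHom_mem_unitBall hi).2 hw)).tsum_eq]
      refine tsum_congr fun n => ?_
      rw [← map_pow]
      rfl
    have hz' : Metric.ball (0 : ℂ) 1 ∈ 𝓝 z := Metric.isOpen_ball.mem_nhds (mem_ball_zero_iff.2 hz)
    exact ⟨_, (hasDerivAt_slice_iff hi).1 (hd'.differentiableAt hz').hasDerivAt⟩
  -- Solving `F(z) = α + iβ` and `F(z̄) = α - iβ` on the fixed slice, with `i⁻¹ = -i`.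
  refine ⟨fun x y => (2⁻¹ : ℝ) • (F ⟨x, y⟩ + F ⟨x, -y⟩),
    fun x y => -(i * ((2⁻¹ : ℝ) • (F ⟨x, y⟩ - F ⟨x, -y⟩))), fun j hj x y hxy => ?_⟩
  rw [slicePoint_eq_sliceHom hj, sliceHom_mem_unitBall hj] at hxy
  have hxy' : ‖(⟨x, -y⟩ : ℂ)‖ < 1 := by
    have : (⟨x, -y⟩ : ℂ) = (starRingEnd ℂ) ⟨x, y⟩ := rfl
    rwa [this, RCLike.norm_conj]
  refine ⟨?_, ?_, ?_, ?_⟩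
  · rw [slicePoint_eq_sliceHom hj, eq_rep_of_hasSum hf hi hj hxy]
    change repLeft i j * F ⟨x, y⟩ + repRight i j * F ⟨x, -y⟩ = _
    simp only [repLeft, repRight, smul_mul_assoc, mul_neg, mul_smul_comm, ← smul_neg, ← smul_add]
    congr 1
    noncomm_ring
  · simp [add_comm]
  · simp only [neg_neg]
    rw [← mul_neg, ← smul_neg, neg_sub]
  · obtain ⟨d, hd⟩ := hFd _ hxy
    obtain ⟨d', hd'⟩ := hFd _ hxy'
    have hI : ∀ x y : ℝ, (⟨x, y⟩ : ℂ) = x + y * Complex.I := fun x y => by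
      apply Complex.ext <;> simp
    have l1 : HasDerivAt (fun t : ℝ => (⟨t, y⟩ : ℂ)) 1 x := by
      simp_rw [hI]
      exact (Complex.ofRealCLM.hasDerivAt (x := x)).add_const _
    have l2 : HasDerivAt (fun t : ℝ => (⟨t, -y⟩ : ℂ)) 1 x := by
      simp_rw [hI]
      exact (Complex.ofRealCLM.hasDerivAt (x := x)).add_const _
    have l3 : HasDerivAt (fun t : ℝ => (⟨x, t⟩ : ℂ)) Complex.I y := by
      simp_rw [hI]
      simpa using ((Complex.ofRealCLM.hasDerivAt (x := y)).mul_const Complex.I).const_add (x : ℂ)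
    have l4 : HasDerivAt (fun t : ℝ => (⟨x, -t⟩ : ℂ)) (-Complex.I) y := by
      simp_rw [hI]
      simpa using ((Complex.ofRealCLM.hasDerivAt (x := y)).neg.mul_const Complex.I).const_add (x : ℂ)
    have m1 : HasDerivAt (fun t : ℝ => F ⟨t, y⟩) d x := by
      simpa [sliceMulCLM_apply] using! hd.comp_hasDerivAt x l1
    have m2 : HasDerivAt (fun t : ℝ => F ⟨t, -y⟩) d' x := by
      simpa [sliceMulCLM_apply] using! hd'.comp_hasDerivAt x l2
    have hsI : sliceHom hi Complex.I = i := by simp [sliceHom_apply]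
    have m3 : HasDerivAt (fun t : ℝ => F ⟨x, t⟩) (i * d) y := by
      simpa [sliceMulCLM_apply, hsI] using! hd.comp_hasDerivAt y l3
    have m4 : HasDerivAt (fun t : ℝ => F ⟨x, -t⟩) (-(i * d')) y := by
      simpa [sliceMulCLM_apply, hsI] using! hd'.comp_hasDerivAt y l4
    refine ⟨(2⁻¹ : ℝ) • (d + d'), -(i * ((2⁻¹ : ℝ) • (d - d'))), ?_, ?_, ?_, ?_⟩
    · exact (m1.add m2).const_smul (2⁻¹ : ℝ)
    · convert! (((m3.sub m4).const_smul (2⁻¹ : ℝ)).const_mul i).neg using 1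
      rw [sub_neg_eq_add, ← mul_add, ← mul_smul_comm, ← mul_assoc, mul_self_of_mem_imUnits hi]
      simp
    · exact (((m1.sub m2).const_smul (2⁻¹ : ℝ)).const_mul i).neg
    · convert! (m3.add m4).const_smul (2⁻¹ : ℝ) using 1
      rw [neg_neg, ← sub_eq_add_neg, ← mul_sub, mul_smul_comm]

/-! ### The Hardy space in terms of coefficients -/

lemma zeroExt_of_mem (f : unitBall → ℍ[ℝ]) {x : ℍ[ℝ]} (hx : x ∈ unitBall) :
    zeroExt f x = f ⟨x, hx⟩ :=
  Subtype.val_injective.extend_apply f 0 ⟨x, hx⟩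

/-- The function `f` on the unit ball is the power series with the square summable coefficients
`a`. -/
def HasCoeff (f : unitBall → ℍ[ℝ]) (a : ℕ → ℍ[ℝ]) : Prop :=
  (Summable fun n => ‖a n‖ ^ 2) ∧ ∀ x ∈ unitBall, HasSum (fun n => x ^ n * a n) (zeroExt f x)

lemma summable_sq_sub {a b : ℕ → ℍ[ℝ]} (ha : Summable fun n => ‖a n‖ ^ 2)
    (hb : Summable fun n => ‖b n‖ ^ 2) : Summable fun n => ‖a n - b n‖ ^ 2 := by
  refine Summable.of_nonneg_of_le (fun n => by positivity) (fun n => ?_)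
    ((ha.mul_left 2).add (hb.mul_left 2))
  have := norm_sub_le (a n) (b n)
  nlinarith [norm_nonneg (a n - b n), sq_nonneg (‖a n‖ - ‖b n‖)]

lemma HasCoeff.sub {f g : unitBall → ℍ[ℝ]} {a b : ℕ → ℍ[ℝ]} (hf : HasCoeff f a)
    (hg : HasCoeff g b) : HasCoeff (f - g) (fun n => a n - b n) := by
  refine ⟨summable_sq_sub hf.1 hg.1, fun x hx => ?_⟩
  have h := (hf.2 x hx).sub (hg.2 x hx)
  rw [zeroExt_of_mem _ hx] at h ⊢
  rw [zeroExt_of_mem _ hx] at h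
  simpa [mul_sub] using h

lemma HasCoeff.add {f g : unitBall → ℍ[ℝ]} {a b : ℕ → ℍ[ℝ]} (hf : HasCoeff f a)
    (hg : HasCoeff g b) : HasCoeff (f + g) (fun n => a n + b n) := by
  refine ⟨?_, fun x hx => ?_⟩
  · have := summable_sq_sub hf.1 (b := fun n => -b n) (by simpa using hg.1)
    simpa using this
  · have h := (hf.2 x hx).add (hg.2 x hx)
    rw [zeroExt_of_mem _ hx] at h ⊢
    rw [zeroExt_of_mem _ hx] at h
    simpa [mul_add] using h

lemma HasCoeff.smul {f : unitBall → ℍ[ℝ]} {a : ℕ → ℍ[ℝ]} (hf : HasCoeff f a) (c : ℍ[ℝ]) :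
    HasCoeff (MulOpposite.op c • f) (fun n => a n * c) := by
  refine ⟨?_, fun x hx => ?_⟩
  · simp_rw [norm_mul, mul_pow]
    exact hf.1.mul_right _
  · have h := (hf.2 x hx).mul_right c
    rw [zeroExt_of_mem _ hx] at h ⊢
    simpa [mul_assoc] using h

lemma hasCoeff_const (c : ℍ[ℝ]) : HasCoeff (fun _ => c) (Pi.single 0 c) := by
  refine ⟨summable_of_ne_finset_zero (s := {0}) fun n hn => ?_, fun x hx => ?_⟩
  · have : n ≠ 0 := by simpa using hn
    simp [this]
  · rw [zeroExt_of_mem _ hx]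
    convert! hasSum_single (f := fun n => x ^ n * (Pi.single 0 c : ℕ → ℍ[ℝ]) n) 0 ?_ using 1
    · simp
    · intro n hn
      simp [hn]

lemma HasCoeff.coeff_zero {f : unitBall → ℍ[ℝ]} {a : ℕ → ℍ[ℝ]} (hf : HasCoeff f a) :
    f center = a 0 := by
  have h := hf.2 0 (Metric.mem_ball_self one_pos)
  rw [zeroExt_of_mem _ (Metric.mem_ball_self one_pos)] at h
  refine h.unique ?_
  convert! hasSum_single (f := fun n => (0 : ℍ[ℝ]) ^ n * a n) 0 ?_ using 1
  · simp
  · intro n hn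
    simp [hn]

lemma exists_bound_of_summable_sq {a : ℕ → ℍ[ℝ]} (ha : Summable fun n => ‖a n‖ ^ 2) :
    ∃ C, ∀ n, ‖a n‖ ≤ C := by
  refine ⟨Real.sqrt (∑' n, ‖a n‖ ^ 2), fun n => ?_⟩
  exact Real.le_sqrt_of_sq_le (ha.le_tsum n fun m _ => by positivity)

lemma summable_norm_of_hasSum {f : ℍ[ℝ] → ℍ[ℝ]} {a : ℕ → ℍ[ℝ]}
    (hf : ∀ x ∈ unitBall, HasSum (fun n => x ^ n * a n) (f x)) {r : ℝ} (h0 : 0 ≤ r) (h1 : r < 1) :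
    Summable fun n => ‖(r ^ n) • a n‖ := by
  have hr : ((r : ℝ) : ℍ[ℝ]) ∈ unitBall := by
    rw [mem_ball_zero_iff, Quaternion.norm_coe, Real.norm_of_nonneg h0]; exact h1
  refine (summable_norm_iff.2 (hf _ hr).summable).congr fun n => ?_
  rw [norm_mul, norm_pow, Quaternion.norm_coe, norm_smul, norm_pow]

/-- Parseval on the circle of radius `r`, whose coefficients are `r ^ n • a n`. The right-hand side
is independent of the slice. -/
lemma hardyMean_eq {f : unitBall → ℍ[ℝ]} {a : ℕ → ℍ[ℝ]}
    (hf : ∀ x ∈ unitBall, HasSum (fun n => x ^ n * a n) (zeroExt f x)) {i : ℍ[ℝ]}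
    (hi : i ∈ imUnits) {r : ℝ} (h0 : 0 ≤ r) (h1 : r < 1) :
    hardyMean f i r = ENNReal.ofReal (∑' n, ‖(r ^ n) • a n‖ ^ 2) ^ (1 / 2 : ℝ) := by
  have hs := summable_norm_of_hasSum hf h0 h1
  rw [hardyMean, setLIntegral_congr Ioo_ae_eq_Ioc]
  have e : ∀ θ, zeroExt f (polarPoint i r θ) = ∑' n, sliceHom hi (circ θ) ^ n * ((r ^ n) • a n) := by
    intro θ
    rw [← (hf _ (polarPoint_mem hi h0 h1 θ)).tsum_eq]
    refine tsum_congr fun n => ?_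
    rw [polarPoint_eq hi, ← Complex.real_smul, map_smul, smul_pow, smul_mul_assoc, mul_smul_comm]
  simp_rw [e]
  rw [lintegral_norm_sq_tsum_slice hi hs, ← ENNReal.ofReal_mul (by positivity), ← mul_assoc]
  have := Real.pi_ne_zero
  rw [one_div_mul_cancel (by positivity), one_mul]

/-- Near `r = 1` the means stay below some finite `K`, so each finite sum of the `‖(r ^ n) • a n‖ ^
2` is at most `K ^ 2`, and in a finite sum `r` may tend to 1. -/
lemma summable_sq_of_hardyNorm_lt_top {f : unitBall → ℍ[ℝ]} {a : ℕ → ℍ[ℝ]}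
    (hf : ∀ x ∈ unitBall, HasSum (fun n => x ^ n * a n) (zeroExt f x)) (h : hardyNorm f < ∞) :
    Summable fun n => ‖a n‖ ^ 2 := by
  obtain ⟨i, hi⟩ := exists_mem_imUnits
  have h1 : limsup (fun r => hardyMean f i r) (𝓝[<] (1 : ℝ)) < ∞ :=
    lt_of_le_of_lt (le_iSup₂_of_le i hi le_rfl) h
  obtain ⟨K, hK1, hK2⟩ := exists_between h1
  have h2 := eventually_lt_of_limsup_lt hK1
  refine summable_of_sum_le (c := (K ^ (2 : ℝ)).toReal) (fun n => by positivity) fun s => ?_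
  have hlim : Tendsto (fun r : ℝ => ∑ n ∈ s, ‖(r ^ n) • a n‖ ^ 2) (𝓝[<] 1)
      (𝓝 (∑ n ∈ s, ‖((1 : ℝ) ^ n) • a n‖ ^ 2)) := by
    have : Continuous fun r : ℝ => ∑ n ∈ s, ‖(r ^ n) • a n‖ ^ 2 :=
      continuous_finsetSum _ fun n _ => by fun_prop
    exact (this.tendsto 1).mono_left nhdsWithin_le_nhds
  simp only [one_pow, one_smul] at hlim
  refine le_of_tendsto hlim ?_
  filter_upwards [h2, Ioo_mem_nhdsLT (zero_lt_one' ℝ)] with r hr hr01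
  rw [hardyMean_eq hf hi hr01.1.le hr01.2] at hr
  have hs := summable_norm_of_hasSum hf hr01.1.le hr01.2
  have hsq : Summable fun n => ‖(r ^ n) • a n‖ ^ 2 := by
    refine Summable.of_norm_bounded_eventually_nat hs ?_
    filter_upwards [hs.tendsto_atTop_zero.eventually (gt_mem_nhds one_pos)] with n hn
    rw [Real.norm_of_nonneg (by positivity), sq]
    exact mul_le_of_le_one_left (norm_nonneg _) hn.le
  refine (hsq.sum_le_tsum s fun n _ => by positivity).trans ?_
  have h3 := ENNReal.rpow_le_rpow hr.le (by norm_num : (0 : ℝ) ≤ 2)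
  rw [← ENNReal.rpow_mul] at h3
  norm_num at h3
  rw [ENNReal.ofReal_le_iff_le_toReal (by simpa using hK2.ne)] at h3
  simpa using h3

lemma HasCoeff.hardyNorm_lt_top {f : unitBall → ℍ[ℝ]} {a : ℕ → ℍ[ℝ]} (hf : HasCoeff f a) :
    hardyNorm f < ∞ := by
  have hle : hardyNorm f ≤ ENNReal.ofReal (∑' n, ‖a n‖ ^ 2) ^ (1 / 2 : ℝ) := by
    refine iSup₂_le fun i hi => limsup_le_of_le (h := ?_)
    filter_upwards [Ioo_mem_nhdsLT (zero_lt_one' ℝ)] with r hr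
    rw [hardyMean_eq hf.2 hi hr.1.le hr.2]
    have hb : ∀ n, ‖(r ^ n) • a n‖ ^ 2 ≤ ‖a n‖ ^ 2 := by
      intro n
      rw [norm_smul, Real.norm_of_nonneg (pow_nonneg hr.1.le n)]
      have h1 : r ^ n * ‖a n‖ ≤ ‖a n‖ :=
        mul_le_of_le_one_left (norm_nonneg _) (pow_le_one₀ hr.1.le hr.2.le)
      exact pow_le_pow_left₀ (mul_nonneg (pow_nonneg hr.1.le n) (norm_nonneg _)) h1 2
    exact ENNReal.rpow_le_rpow (ENNReal.ofReal_le_ofReal (Summable.tsum_le_tsum hb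
      (Summable.of_nonneg_of_le (fun n => by positivity) hb hf.1) hf.1)) (by norm_num)
  exact lt_of_le_of_lt hle (ENNReal.rpow_lt_top_of_nonneg (by norm_num) ENNReal.ofReal_ne_top)

/-- The functions in the Hardy space are the power series with square summable coefficients. -/
theorem mem_hardySpace_iff {f : unitBall → ℍ[ℝ]} : f ∈ hardySpace ↔ ∃ a, HasCoeff f a := by
  constructor
  · rintro ⟨h1, h2⟩
    obtain ⟨a, ha⟩ := exists_hasSum_of_isSliceHyperholomorphicOn h1
    exact ⟨a, summable_sq_of_hardyNorm_lt_top ha h2, ha⟩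
  · rintro ⟨a, ha⟩
    obtain ⟨C, hC⟩ := exists_bound_of_summable_sq ha.1
    exact ⟨isSliceHyperholomorphicOn_of_hasSum hC ha.2, ha.hardyNorm_lt_top⟩

/-- Every square summable sequence is the coefficient sequence of a function. -/
lemma exists_hasCoeff {a : ℕ → ℍ[ℝ]} (ha : Summable fun n => ‖a n‖ ^ 2) : ∃ f, HasCoeff f a := by
  obtain ⟨C, hC⟩ := exists_bound_of_summable_sq ha
  refine ⟨fun x => ∑' n, (x : ℍ[ℝ]) ^ n * a n, ha, fun x hx => ?_⟩
  rw [zeroExt_of_mem _ hx]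
  have hx1 : ‖x‖ < 1 := mem_ball_zero_iff.1 hx
  refine (Summable.of_norm_bounded ((summable_geometric_of_lt_one (norm_nonneg x) hx1).mul_right C)
    fun n => ?_).hasSum
  rw [norm_mul, norm_pow]
  exact mul_le_mul_of_nonneg_left (hC n) (by positivity)

/-! ### Boundary values -/

lemma polarPoint_add_two_pi (i : ℍ[ℝ]) (r θ : ℝ) :
    polarPoint i r (θ + 2 * Real.pi) = polarPoint i r θ := by
  simp [polarPoint]

lemma periodic_radialLimit (f : unitBall → ℍ[ℝ]) (i : ℍ[ℝ]) :
    Function.Periodic (radialLimit f i) (2 * Real.pi) := by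
  intro θ
  simp only [radialLimit, polarPoint_add_two_pi]

/-- A periodic predicate that holds almost everywhere on a period holds almost everywhere. -/
lemma ae_of_periodic {P : ℝ → Prop} (hP : Function.Periodic P (2 * Real.pi))
    (h : ∀ᵐ θ ∂(volume.restrict (Set.Ioc 0 (2 * Real.pi))), P θ) : ∀ᵐ θ, P θ := by
  rw [ae_restrict_iff' measurableSet_Ioc, ae_iff] at h
  rw [ae_iff]
  refine measure_mono_null (t := ⋃ k : ℤ, (fun θ => θ + k • (2 * Real.pi)) ⁻¹'
    {θ | ¬(θ ∈ Set.Ioc 0 (2 * Real.pi) → P θ)}) ?_ (measure_iUnion_null fun k => ?_)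
  · intro θ hθ
    obtain ⟨k, hk, -⟩ := existsUnique_add_zsmul_mem_Ioc Real.two_pi_pos θ 0
    rw [zero_add] at hk
    refine Set.mem_iUnion.2 ⟨k, ?_⟩
    simp only [Set.mem_preimage, Set.mem_ofPred_eq, Classical.not_imp]
    refine ⟨hk, ?_⟩
    rw [hP.zsmul k θ]
    exact hθ
  · rw [measure_preimage_add_right]
    exact h

/-- Almost everywhere existence of the radial limits. -/
lemma HasCoeff.ae_tendsto {f : unitBall → ℍ[ℝ]} {a : ℕ → ℍ[ℝ]} (hf : HasCoeff f a) {i : ℍ[ℝ]}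
    (hi : i ∈ imUnits) : ∀ᵐ θ : ℝ,
      Tendsto (fun r => zeroExt f (polarPoint i r θ)) (𝓝[<] (1 : ℝ)) (𝓝 (radialLimit f i θ)) := by
  refine ae_of_periodic (fun θ => ?_) ?_
  · simp only [polarPoint_add_two_pi, periodic_radialLimit f i θ]
  · obtain ⟨g, hg, -⟩ := exists_radial_limit_slice hi hf.1
    filter_upwards [hg] with θ hθ
    refine tendsto_nhds_limUnder ⟨g θ, hθ.congr' ?_⟩
    filter_upwards [Ioo_mem_nhdsLT (zero_lt_one' ℝ)] with r hr
    exact (hf.2 _ (polarPoint_mem hi hr.1.le hr.2 θ)).tsum_eq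

/-- Parseval's identity for the boundary values. -/
lemma HasCoeff.lintegral_radialLimit {f : unitBall → ℍ[ℝ]} {a : ℕ → ℍ[ℝ]} (hf : HasCoeff f a)
    {i : ℍ[ℝ]} (hi : i ∈ imUnits) (c : ℝ) :
    ∫⁻ θ in Set.Ioc c (c + 2 * Real.pi), ‖radialLimit f i θ‖ₑ ^ 2
      = ENNReal.ofReal (2 * Real.pi * ∑' n, ‖a n‖ ^ 2) := by
  have h0 : ∫⁻ θ in Set.Ioc c (c + 2 * Real.pi), ‖radialLimit f i θ‖ₑ ^ 2
      = ∫⁻ θ in Set.Ioc 0 (0 + 2 * Real.pi), ‖radialLimit f i θ‖ₑ ^ 2 := by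
    refine (isAddFundamentalDomain_Ioc Real.two_pi_pos c).setLIntegral_eq
      (isAddFundamentalDomain_Ioc Real.two_pi_pos 0) _ ?_
    rintro ⟨g, hg⟩ x
    obtain ⟨k, rfl⟩ := AddSubgroup.mem_zmultiples_iff.1 hg
    have := (periodic_radialLimit f i).zsmul k x
    change ‖radialLimit f i (k • (2 * Real.pi) + x)‖ₑ ^ 2 = _
    rw [add_comm, this]
  rw [h0, zero_add]
  obtain ⟨g, hg, hg2⟩ := exists_radial_limit_slice hi hf.1
  rw [← hg2]
  refine lintegral_congr_ae ?_
  filter_upwards [hg, ae_restrict_of_ae (hf.ae_tendsto hi)] with θ h1 h2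
  have h3 : Tendsto (fun r => zeroExt f (polarPoint i r θ)) (𝓝[<] (1 : ℝ)) (𝓝 (g θ)) := by
    refine h1.congr' ?_
    filter_upwards [Ioo_mem_nhdsLT (zero_lt_one' ℝ)] with r hr
    exact (hf.2 _ (polarPoint_mem hi hr.1.le hr.2 θ)).tsum_eq
  rw [tendsto_nhds_unique h2 h3]

/-- Along a sequence of radii increasing to 1, the boundary function is an almost everywhere limit
of continuous functions. -/
lemma HasCoeff.aestronglyMeasurable {f : unitBall → ℍ[ℝ]} {a : ℕ → ℍ[ℝ]} (hf : HasCoeff f a)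
    {i : ℍ[ℝ]} (hi : i ∈ imUnits) : AEStronglyMeasurable (radialLimit f i) volume := by
  obtain ⟨C, hC⟩ := exists_bound_of_summable_sq hf.1
  have hcont := (differentiableOn_of_hasSum hC hf.2).continuousOn
  obtain ⟨u, -, hu, hulim⟩ := exists_seq_strictMono_tendsto' (zero_lt_one' ℝ)
  refine aestronglyMeasurable_of_tendsto_ae atTop
    (f := fun n θ => zeroExt f (polarPoint i (u n) θ)) (fun n => ?_) ?_
  · refine Continuous.aestronglyMeasurable ?_
    refine hcont.comp_continuous ?_ fun θ => polarPoint_mem hi (hu n).1.le (hu n).2 θ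
    unfold polarPoint
    simp_rw [slicePoint_eq]
    fun_prop
  · filter_upwards [hf.ae_tendsto hi] with θ hθ
    refine hθ.comp (tendsto_nhdsWithin_iff.2 ⟨hulim, Eventually.of_forall fun n => (hu n).2⟩)

lemma HasCoeff.eLpNorm_radialLimit_sq_le {f : unitBall → ℍ[ℝ]} {a : ℕ → ℍ[ℝ]} (hf : HasCoeff f a)
    {i : ℍ[ℝ]} (hi : i ∈ imUnits) {c d : ℝ} (hcd : d - c ≤ 2 * Real.pi) :
    eLpNorm (radialLimit f i) 2 (volume.restrict (Set.Ioo c d)) ^ 2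
      ≤ ENNReal.ofReal (2 * Real.pi * ∑' n, ‖a n‖ ^ 2) := by
  rw [eLpNorm_two_sq, ← hf.lintegral_radialLimit hi c]
  refine lintegral_mono_set fun x hx => ⟨hx.1, ?_⟩
  linarith [hx.2]

lemma HasCoeff.memLp {f : unitBall → ℍ[ℝ]} {a : ℕ → ℍ[ℝ]} (hf : HasCoeff f a)
    {i : ℍ[ℝ]} (hi : i ∈ imUnits) {c d : ℝ} (hcd : d - c ≤ 2 * Real.pi) :
    MemLp (radialLimit f i) 2 (volume.restrict (Set.Ioo c d)) := by
  refine ⟨(hf.aestronglyMeasurable hi).restrict, ?_⟩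
  have h := (hf.eLpNorm_radialLimit_sq_le hi hcd).trans_lt ENNReal.ofReal_lt_top
  exact (ENNReal.pow_lt_top_iff.1 h).resolve_right two_ne_zero

lemma HasCoeff.radialLimit_sub {f g : unitBall → ℍ[ℝ]} {a b : ℕ → ℍ[ℝ]} (hf : HasCoeff f a)
    (hg : HasCoeff g b) {i : ℍ[ℝ]} (hi : i ∈ imUnits) :
    radialLimit (f - g) i =ᵐ[volume] fun θ => radialLimit f i θ - radialLimit g i θ := by
  filter_upwards [hf.ae_tendsto hi, hg.ae_tendsto hi] with θ h1 h2
  refine ((h1.sub h2).congr' ?_).limUnder_eq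
  filter_upwards [Ioo_mem_nhdsLT (zero_lt_one' ℝ)] with r hr
  have hm := polarPoint_mem hi hr.1.le hr.2 θ
  simp [zeroExt_of_mem _ hm]

lemma HasCoeff.radialLimit_add {f g : unitBall → ℍ[ℝ]} {a b : ℕ → ℍ[ℝ]} (hf : HasCoeff f a)
    (hg : HasCoeff g b) {i : ℍ[ℝ]} (hi : i ∈ imUnits) :
    radialLimit (f + g) i =ᵐ[volume] fun θ => radialLimit f i θ + radialLimit g i θ := by
  filter_upwards [hf.ae_tendsto hi, hg.ae_tendsto hi] with θ h1 h2
  refine ((h1.add h2).congr' ?_).limUnder_eq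
  filter_upwards [Ioo_mem_nhdsLT (zero_lt_one' ℝ)] with r hr
  have hm := polarPoint_mem hi hr.1.le hr.2 θ
  simp [zeroExt_of_mem _ hm]

lemma HasCoeff.radialLimit_smul {f : unitBall → ℍ[ℝ]} {a : ℕ → ℍ[ℝ]} (hf : HasCoeff f a)
    (c : ℍ[ℝ]) {i : ℍ[ℝ]} (hi : i ∈ imUnits) :
    radialLimit (MulOpposite.op c • f) i =ᵐ[volume] fun θ => radialLimit f i θ * c := by
  filter_upwards [hf.ae_tendsto hi] with θ h1
  refine ((h1.mul_const c).congr' ?_).limUnder_eq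
  filter_upwards [Ioo_mem_nhdsLT (zero_lt_one' ℝ)] with r hr
  have hm := polarPoint_mem hi hr.1.le hr.2 θ
  simp [zeroExt_of_mem _ hm]

lemma radialLimit_const (c : ℍ[ℝ]) {i : ℍ[ℝ]} (hi : i ∈ imUnits) (θ : ℝ) :
    radialLimit (fun _ => c) i θ = c := by
  refine (tendsto_const_nhds.congr' ?_).limUnder_eq
  filter_upwards [Ioo_mem_nhdsLT (zero_lt_one' ℝ)] with r hr
  rw [zeroExt_of_mem _ (polarPoint_mem hi hr.1.le hr.2 θ)]

/-- The representation formula for the boundary values. -/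
lemma HasCoeff.radialLimit_rep {f : unitBall → ℍ[ℝ]} {a : ℕ → ℍ[ℝ]} (hf : HasCoeff f a)
    {i j : ℍ[ℝ]} (hi : i ∈ imUnits) (hj : j ∈ imUnits) :
    radialLimit f j =ᵐ[volume] fun θ =>
      repLeft i j * radialLimit f i θ + repRight i j * radialLimit f i (-θ) := by
  -- Reflection preserves null sets, so the radial limit exists at `θ` and at `-θ` simultaneously
  -- for almost every `θ`.
  have hneg := (Measure.measurePreserving_neg (volume : Measure ℝ)).quasiMeasurePreserving.ae
    (hf.ae_tendsto hi)
  filter_upwards [hf.ae_tendsto hi, hneg] with θ h1 h2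
  refine (((h1.const_mul (repLeft i j)).add (h2.const_mul (repRight i j))).congr' ?_).limUnder_eq
  filter_upwards [Ioo_mem_nhdsLT (zero_lt_one' ℝ)] with r hr
  have hz : ‖(r : ℂ) * circ θ‖ < 1 := by rw [norm_real_mul_circ hr.1.le]; exact hr.2
  have hc : (starRingEnd ℂ) ((r : ℂ) * circ θ) = r * circ (-θ) := by
    simp [circ, ← Complex.exp_conj]
  rw [polarPoint_eq hi, polarPoint_eq hi, polarPoint_eq hj, eq_rep_of_hasSum hf.2 hi hj hz, hc]

/-! ### Mean oscillation over an interval -/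

/-- The average of `h` over the interval `(a, b)`. -/
def intervalAvg (h : ℝ → ℍ[ℝ]) (a b : ℝ) : ℍ[ℝ] := (1 / (b - a)) • ∫ θ in Set.Ioo a b, h θ

/-- The square root of the mean quadratic oscillation of `h` over the interval `(a, b)`. -/
def oscil (h : ℝ → ℍ[ℝ]) (a b : ℝ) : ℝ≥0∞ :=
  ENNReal.ofReal (1 / (b - a)) ^ (1 / 2 : ℝ) *
    eLpNorm (fun θ => h θ - intervalAvg h a b) 2 (volume.restrict (Set.Ioo a b))

lemma rpow_half_sq (x : ℝ≥0∞) : (x ^ (1 / 2 : ℝ)) ^ 2 = x := by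
  rw [← ENNReal.rpow_natCast, ← ENNReal.rpow_mul]
  norm_num

lemma sq_rpow_half (x : ℝ≥0∞) : (x ^ 2) ^ (1 / 2 : ℝ) = x := by
  rw [← ENNReal.rpow_natCast, ← ENNReal.rpow_mul]
  norm_num

lemma oscil_sq (f : unitBall → ℍ[ℝ]) (i : ℍ[ℝ]) (a b : ℝ) :
    oscil (radialLimit f i) a b ^ 2 = meanOscillation f i a b := by
  rw [oscil, mul_pow, rpow_half_sq, eLpNorm_two_sq]
  rfl

lemma sliceSeminorm_le_iff {i : ℍ[ℝ]} {f : unitBall → ℍ[ℝ]} {K : ℝ≥0∞} :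
    sliceSeminorm i f ≤ K ↔
      ∀ a b : ℝ, a < b → b - a ≤ 2 * Real.pi → oscil (radialLimit f i) a b ≤ K := by
  have h1 : sliceSeminorm i f ≤ K ↔ (⨆ (a : ℝ) (b : ℝ) (_ : a < b) (_ : b - a ≤ 2 * Real.pi),
      meanOscillation f i a b) ≤ K ^ 2 := by
    rw [sliceSeminorm]
    constructor
    · intro h
      have := pow_le_pow_left₀ zero_le h 2
      rwa [rpow_half_sq] at this
    · intro h
      have := ENNReal.rpow_le_rpow h (by norm_num : (0 : ℝ) ≤ 1 / 2)
      rwa [sq_rpow_half] at this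
  rw [h1]
  simp only [iSup_le_iff, ← oscil_sq]
  exact forall₂_congr fun a b => forall₂_congr fun _ _ =>
    ENNReal.pow_le_pow_left_iff two_ne_zero

lemma oscil_le_sliceSeminorm (i : ℍ[ℝ]) (f : unitBall → ℍ[ℝ]) {a b : ℝ} (hab : a < b)
    (h : b - a ≤ 2 * Real.pi) : oscil (radialLimit f i) a b ≤ sliceSeminorm i f :=
  sliceSeminorm_le_iff.1 le_rfl a b hab h

lemma oscil_congr {h k : ℝ → ℍ[ℝ]} (hk : h =ᵐ[volume] k) (a b : ℝ) : oscil h a b = oscil k a b := by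
  have e : intervalAvg h a b = intervalAvg k a b := by
    rw [intervalAvg, intervalAvg, integral_congr_ae (ae_restrict_of_ae hk)]
  rw [oscil, oscil, e]
  congr 1
  refine eLpNorm_congr_ae (ae_restrict_of_ae ?_)
  filter_upwards [hk] with θ hθ
  rw [hθ]

lemma oscil_add_le {h k : ℝ → ℍ[ℝ]} {a b : ℝ} (hh : MemLp h 2 (volume.restrict (Set.Ioo a b)))
    (hk : MemLp k 2 (volume.restrict (Set.Ioo a b))) :
    oscil (fun θ => h θ + k θ) a b ≤ oscil h a b + oscil k a b := by
  have e : intervalAvg (fun θ => h θ + k θ) a b = intervalAvg h a b + intervalAvg k a b := by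
    rw [intervalAvg, intervalAvg, intervalAvg, integral_add (hh.integrable (by norm_num))
      (hk.integrable (by norm_num)), smul_add]
  rw [oscil, oscil, oscil, ← mul_add, e]
  gcongr
  have hc : ∀ c : ℍ[ℝ], AEStronglyMeasurable (fun _ : ℝ => c) (volume.restrict (Set.Ioo a b)) :=
    fun c => aestronglyMeasurable_const
  convert! eLpNorm_add_le (hh.1.sub (hc (intervalAvg h a b))) (hk.1.sub (hc (intervalAvg k a b)))
    (by norm_num : (1 : ℝ≥0∞) ≤ 2) using 2
  ext1 θ
  simp only [Pi.add_apply, Pi.sub_apply]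
  abel

lemma oscil_const_mul_le (c : ℍ[ℝ]) {h : ℝ → ℍ[ℝ]} {a b : ℝ}
    (hh : MemLp h 2 (volume.restrict (Set.Ioo a b))) :
    oscil (fun θ => c * h θ) a b ≤ ‖c‖ₑ * oscil h a b := by
  have e : intervalAvg (fun θ => c * h θ) a b = c * intervalAvg h a b := by
    rw [intervalAvg, intervalAvg, integral_const_mul_of_integrable (hh.integrable (by norm_num)),
      mul_smul_comm]
  rw [oscil, oscil, e, mul_left_comm]
  gcongr
  refine (eLpNorm_le_nnreal_smul_eLpNorm_of_ae_le_mul (c := ‖c‖₊) (Eventually.of_forall fun θ => ?_)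
    _).trans_eq (by rfl)
  rw [← mul_sub, nnnorm_mul]

lemma oscil_mul_const (c : ℍ[ℝ]) {h : ℝ → ℍ[ℝ]} {a b : ℝ}
    (hh : MemLp h 2 (volume.restrict (Set.Ioo a b))) :
    oscil (fun θ => h θ * c) a b = oscil h a b * ‖c‖ₑ := by
  have e : intervalAvg (fun θ => h θ * c) a b = intervalAvg h a b * c := by
    rw [intervalAvg, intervalAvg, integral_mul_const_of_integrable (hh.integrable (by norm_num)),
      smul_mul_assoc]
  rw [oscil, oscil, e, mul_assoc]
  congr 1
  simp_rw [← sub_mul]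
  have h1 : ∀ θ, ‖(h θ - intervalAvg h a b) * c‖ₑ = ‖‖c‖ • (h θ - intervalAvg h a b)‖ₑ := by
    intro θ
    rw [enorm_mul, enorm_smul, mul_comm, enorm_norm]
  rw [eLpNorm_congr_enorm_ae (Eventually.of_forall h1)]
  have := eLpNorm_const_smul ‖c‖ (fun θ => h θ - intervalAvg h a b) 2
    (volume.restrict (Set.Ioo a b))
  rw [enorm_norm, mul_comm] at this
  exact this

lemma oscil_comp_neg (h : ℝ → ℍ[ℝ]) (a b : ℝ) :
    oscil (fun θ => h (-θ)) a b = oscil h (-b) (-a) := by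
  have hp : MeasurePreserving (fun θ : ℝ => -θ) (volume.restrict (Set.Ioo a b))
      (volume.restrict (Set.Ioo (-b) (-a))) := by
    have := (Measure.measurePreserving_neg (volume : Measure ℝ)).restrict_preimage
      (measurableSet_Ioo (a := -b) (b := -a))
    simpa using! this
  have he : MeasurableEmbedding (fun θ : ℝ => -θ) := (MeasurableEquiv.neg ℝ).measurableEmbedding
  have e : intervalAvg (fun θ => h (-θ)) a b = intervalAvg h (-b) (-a) := by
    rw [intervalAvg, intervalAvg, hp.integral_comp he h]
    congr 2; ring
  rw [oscil, oscil, e]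
  congr 1
  · congr 3; ring
  · rw [← hp.map_eq, he.eLpNorm_map_measure]
    rfl

/-- One copy of the `L²` norm bounds `h`, the other its average, by the Cauchy-Schwarz inequality.
-/
lemma oscil_le_eLpNorm {h : ℝ → ℍ[ℝ]} {a b : ℝ} (hab : a < b)
    (hh : MemLp h 2 (volume.restrict (Set.Ioo a b))) :
    oscil h a b ≤ ENNReal.ofReal (1 / (b - a)) ^ (1 / 2 : ℝ) *
      (2 * eLpNorm h 2 (volume.restrict (Set.Ioo a b))) := by
  set μ := volume.restrict (Set.Ioo a b) with hμ
  have hba : 0 < b - a := sub_pos.2 hab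
  have hμu : μ Set.univ = ENNReal.ofReal (b - a) := by simp [hμ]
  rw [oscil, two_mul]
  gcongr
  refine (eLpNorm_sub_le hh.1 aestronglyMeasurable_const (by norm_num)).trans ?_
  gcongr
  have hμ0 : μ ≠ 0 := by
    intro h0
    rw [h0] at hμu
    simp at hμu
    linarith
  rw [eLpNorm_const _ (by norm_num) hμ0, hμu]
  have h1 : ‖intervalAvg h a b‖ₑ ≤ ENNReal.ofReal (1 / (b - a)) *
      (eLpNorm h 2 μ * ENNReal.ofReal (b - a) ^ (1 / 2 : ℝ)) := by
    rw [intervalAvg, enorm_smul, Real.enorm_of_nonneg (by positivity)]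
    gcongr
    refine (enorm_integral_le_lintegral_enorm _).trans ?_
    rw [← eLpNorm_one_eq_lintegral_enorm]
    refine (eLpNorm_le_eLpNorm_mul_rpow_measure_univ (q := 2) (by norm_num) hh.1).trans_eq ?_
    rw [hμu]
    norm_num
  refine (mul_le_mul_left h1 _).trans_eq ?_
  have h2 : ENNReal.ofReal (b - a) ^ (1 / 2 : ℝ) * ENNReal.ofReal (b - a) ^ (1 / 2 : ℝ)
      = ENNReal.ofReal (b - a) := by rw [← sq, rpow_half_sq]
  have h3 : ENNReal.ofReal (1 / (b - a)) * ENNReal.ofReal (b - a) = 1 := by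
    rw [← ENNReal.ofReal_mul (by positivity), one_div_mul_cancel hba.ne', ENNReal.ofReal_one]
  rw [ENNReal.toReal_ofNat]
  calc _ = eLpNorm h 2 μ * (ENNReal.ofReal (1 / (b - a)) *
        (ENNReal.ofReal (b - a) ^ (1 / 2 : ℝ) * ENNReal.ofReal (b - a) ^ (1 / 2 : ℝ))) := by ring
    _ = _ := by rw [h2, h3, mul_one]

/-! ### Seminorms, comparison of slices and control of the Hardy norm -/

section

variable {f g : unitBall → ℍ[ℝ]} {a b : ℕ → ℍ[ℝ]} {i : ℍ[ℝ]}

lemma HasCoeff.oscil_add_le (hf : HasCoeff f a) (hg : HasCoeff g b) (hi : i ∈ imUnits)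
    {c d : ℝ} (hcd : d - c ≤ 2 * Real.pi) :
    oscil (radialLimit (f + g) i) c d
      ≤ oscil (radialLimit f i) c d + oscil (radialLimit g i) c d := by
  rw [oscil_congr (hf.radialLimit_add hg hi)]
  exact BMOSH.oscil_add_le (hf.memLp hi hcd) (hg.memLp hi hcd)

lemma HasCoeff.sliceSeminorm_add_le (hf : HasCoeff f a) (hg : HasCoeff g b) (hi : i ∈ imUnits) :
    sliceSeminorm i (f + g) ≤ sliceSeminorm i f + sliceSeminorm i g :=
  sliceSeminorm_le_iff.2 fun _ _ hcd h => (hf.oscil_add_le hg hi h).trans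
    (add_le_add (oscil_le_sliceSeminorm i f hcd h) (oscil_le_sliceSeminorm i g hcd h))

lemma HasCoeff.sliceSeminorm_smul (hf : HasCoeff f a) (hi : i ∈ imUnits) (c : ℍ[ℝ]) :
    sliceSeminorm i (MulOpposite.op c • f) = sliceSeminorm i f * ‖c‖ₑ := by
  have hle : ∀ {f : unitBall → ℍ[ℝ]} {a : ℕ → ℍ[ℝ]} (_ : HasCoeff f a) (c : ℍ[ℝ]),
      sliceSeminorm i (MulOpposite.op c • f) ≤ sliceSeminorm i f * ‖c‖ₑ := by
    intro f a hf c
    refine sliceSeminorm_le_iff.2 fun x y hxy h => ?_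
    rw [oscil_congr (hf.radialLimit_smul c hi), oscil_mul_const c (hf.memLp hi h)]
    gcongr
    exact oscil_le_sliceSeminorm i f hxy h
  -- The reverse inequality is the same bound applied to `f c` and `c⁻¹`; the scalar 0 needs no
  -- inverse.
  refine le_antisymm (hle hf c) ?_
  rcases eq_or_ne c 0 with rfl | hc
  · simp
  have h := hle (hf.smul c) c⁻¹
  rw [smul_smul, ← MulOpposite.op_mul, mul_inv_cancel₀ hc, MulOpposite.op_one, one_smul] at h
  refine (mul_le_mul_left h _).trans_eq ?_
  rw [mul_assoc, ← enorm_mul, inv_mul_cancel₀ hc, enorm_one, mul_one]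

lemma HasCoeff.globalSeminorm_add_le (hf : HasCoeff f a) (hg : HasCoeff g b) :
    globalSeminorm (f + g) ≤ globalSeminorm f + globalSeminorm g :=
  iSup₂_le fun i hi => (hf.sliceSeminorm_add_le hg hi).trans (add_le_add
    (le_iSup₂_of_le i hi le_rfl) (le_iSup₂_of_le i hi le_rfl))

lemma HasCoeff.globalSeminorm_smul (hf : HasCoeff f a) (c : ℍ[ℝ]) :
    globalSeminorm (MulOpposite.op c • f) = globalSeminorm f * ‖c‖ₑ := by
  rw [globalSeminorm, globalSeminorm, ENNReal.iSup_mul]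
  refine iSup_congr fun i => ?_
  rw [ENNReal.iSup_mul]
  exact iSup_congr fun hi => hf.sliceSeminorm_smul hi c

lemma sliceSeminorm_le_globalSeminorm (hi : i ∈ imUnits) : sliceSeminorm i f ≤ globalSeminorm f :=
  le_iSup₂_of_le i hi le_rfl

/-- The global seminorm is bounded by the seminorm on any slice. -/
lemma HasCoeff.globalSeminorm_le (hf : HasCoeff f a) (hi : i ∈ imUnits) :
    globalSeminorm f ≤ 2 * sliceSeminorm i f := by
  refine iSup₂_le fun j hj => sliceSeminorm_le_iff.2 fun c d hcd h => ?_
  have h' : -c - -d ≤ 2 * Real.pi := by linarith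
  have hm := hf.memLp hi h
  have hm' : MemLp (fun θ => radialLimit f i (-θ)) 2 (volume.restrict (Set.Ioo c d)) := by
    have hp : MeasurePreserving (fun θ : ℝ => -θ) (volume.restrict (Set.Ioo c d))
        (volume.restrict (Set.Ioo (-d) (-c))) := by
      have := (Measure.measurePreserving_neg (volume : Measure ℝ)).restrict_preimage
        (measurableSet_Ioo (a := -d) (b := -c))
      simpa using! this
    exact (hf.memLp hi h').comp_measurePreserving hp
  have hl : ‖repLeft i j‖ₑ ≤ 1 := by
    rw [← ofReal_norm, ENNReal.ofReal_le_one]; exact norm_repLeft_le hi hj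
  have hr : ‖repRight i j‖ₑ ≤ 1 := by
    rw [← ofReal_norm, ENNReal.ofReal_le_one]; exact norm_repRight_le hi hj
  rw [oscil_congr (hf.radialLimit_rep hi hj), two_mul]
  have hmul : ∀ (q : ℍ[ℝ]) {k : ℝ → ℍ[ℝ]}, MemLp k 2 (volume.restrict (Set.Ioo c d)) →
      MemLp (fun θ => q * k θ) 2 (volume.restrict (Set.Ioo c d)) := fun q _ hk =>
    ((ContinuousLinearMap.mul ℝ ℍ[ℝ] q).comp_memLp' hk)
  refine (BMOSH.oscil_add_le (hmul _ hm) (hmul _ hm')).trans (add_le_add ?_ ?_)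
  · refine (oscil_const_mul_le _ hm).trans ((mul_le_of_le_one_left zero_le hl).trans ?_)
    exact oscil_le_sliceSeminorm i f hcd h
  · refine (oscil_const_mul_le _ hm').trans ((mul_le_of_le_one_left zero_le hr).trans ?_)
    rw [oscil_comp_neg]
    exact oscil_le_sliceSeminorm i f (neg_lt_neg hcd) h'

/-- The seminorm and the value at the centre control the Hardy norm. -/
lemma HasCoeff.ofReal_tsum_le (hf : HasCoeff f a) (hi : i ∈ imUnits) :
    ENNReal.ofReal (∑' n, ‖a n‖ ^ 2) ≤ ENNReal.ofReal (‖a 0‖ ^ 2) + sliceSeminorm i f ^ 2 := by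
  -- Subtracting the average changes only the coefficient of index 0, so Parseval for `f - c`
  -- expresses the oscillation over a full period by the coefficients. The others are untouched, and
  -- `‖a 0‖ ^ 2` is added separately; `c = a 0` is never needed.
  set c := intervalAvg (radialLimit f i) 0 (2 * Real.pi) with hc
  have hf' := hf.sub (hasCoeff_const c)
  have h1 := hf'.lintegral_radialLimit hi 0
  have hae := hf.radialLimit_sub (hasCoeff_const c) hi
  rw [zero_add] at h1
  have h2 : oscil (radialLimit f i) 0 (2 * Real.pi) ^ 2
      = ENNReal.ofReal (∑' n, ‖a n - (Pi.single 0 c : ℕ → ℍ[ℝ]) n‖ ^ 2) := by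
    rw [oscil, mul_pow, rpow_half_sq, eLpNorm_two_sq, setLIntegral_congr Ioo_ae_eq_Ioc, ← hc]
    have h3 : ∫⁻ θ in Set.Ioc 0 (2 * Real.pi), ‖radialLimit f i θ - c‖ₑ ^ 2
        = ∫⁻ θ in Set.Ioc 0 (2 * Real.pi), ‖radialLimit (f - fun _ => c) i θ‖ₑ ^ 2 := by
      refine lintegral_congr_ae (ae_restrict_of_ae ?_)
      filter_upwards [hae] with θ hθ
      rw [hθ, radialLimit_const c hi]
    rw [h3, h1, sub_zero, ← ENNReal.ofReal_mul (by positivity), ← mul_assoc,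
      one_div_mul_cancel (by positivity), one_mul]
  have h4 : ∑' n, ‖a n‖ ^ 2
      ≤ ‖a 0‖ ^ 2 + ∑' n, ‖a n - (Pi.single 0 c : ℕ → ℍ[ℝ]) n‖ ^ 2 := by
    rw [hf.1.tsum_eq_zero_add, hf'.1.tsum_eq_zero_add]
    have : ∀ n : ℕ, (Pi.single 0 c : ℕ → ℍ[ℝ]) (n + 1) = 0 := fun n => by simp
    simp only [this, sub_zero]
    linarith [sq_nonneg ‖a 0 - (Pi.single 0 c : ℕ → ℍ[ℝ]) 0‖]
  refine (ENNReal.ofReal_le_ofReal h4).trans ?_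
  rw [ENNReal.ofReal_add (by positivity) (tsum_nonneg fun n => by positivity), ← h2]
  gcongr
  exact oscil_le_sliceSeminorm i f Real.two_pi_pos (by simp)

lemma mem_bmoSpace_iff : f ∈ bmoSpace ↔ (∃ a, HasCoeff f a) ∧ globalSeminorm f < ∞ := by
  rw [← mem_hardySpace_iff]; rfl

lemma sliceSeminorm_lt_top (hf : f ∈ bmoSpace) (hi : i ∈ imUnits) : sliceSeminorm i f < ∞ :=
  (sliceSeminorm_le_globalSeminorm hi).trans_lt hf.2

lemma HasCoeff.tsum_le_sliceNorm_sq (hf : HasCoeff f a) (hb : f ∈ bmoSpace) (hi : i ∈ imUnits) :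
    ∑' n, ‖a n‖ ^ 2 ≤ sliceNorm i f ^ 2 := by
  have h := hf.ofReal_tsum_le hi
  have ht := sliceSeminorm_lt_top hb hi
  rw [← ENNReal.ofReal_toReal ht.ne, ← ENNReal.ofReal_pow ENNReal.toReal_nonneg,
    ← ENNReal.ofReal_add (by positivity) (by positivity),
    ENNReal.ofReal_le_ofReal_iff (by positivity)] at h
  rw [sliceNorm, hf.coeff_zero]
  nlinarith [mul_nonneg (norm_nonneg (a 0)) (ENNReal.toReal_nonneg (a := sliceSeminorm i f))]

/-- Finiteness of the seminorm comes from homogeneity with the scalar 0, since `∞ * 0 = 0` in the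
extended reals. -/
lemma zero_mem_bmoSpace : (0 : unitBall → ℍ[ℝ]) ∈ bmoSpace := by
  have h0 : HasCoeff (0 : unitBall → ℍ[ℝ]) (Pi.single 0 0) := hasCoeff_const 0
  refine mem_bmoSpace_iff.2 ⟨⟨_, h0⟩, ?_⟩
  have h := h0.globalSeminorm_smul 0
  rw [smul_zero, enorm_zero, mul_zero] at h
  simp [h]

lemma add_mem_bmoSpace (hf : f ∈ bmoSpace) (hg : g ∈ bmoSpace) : f + g ∈ bmoSpace := by
  rw [mem_bmoSpace_iff] at *
  obtain ⟨⟨a, ha⟩, hf⟩ := hf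
  obtain ⟨⟨b, hb⟩, hg⟩ := hg
  exact ⟨⟨_, ha.add hb⟩, (ha.globalSeminorm_add_le hb).trans_lt (ENNReal.add_lt_top.2 ⟨hf, hg⟩)⟩

lemma smul_mem_bmoSpace (hf : f ∈ bmoSpace) (c : ℍ[ℝ]) : MulOpposite.op c • f ∈ bmoSpace := by
  rw [mem_bmoSpace_iff] at *
  obtain ⟨⟨a, ha⟩, hf⟩ := hf
  refine ⟨⟨_, ha.smul c⟩, ?_⟩
  rw [ha.globalSeminorm_smul]
  exact ENNReal.mul_lt_top hf enorm_lt_top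

lemma sub_eq_add_smul (f g : unitBall → ℍ[ℝ]) : f - g = f + MulOpposite.op (-1 : ℍ[ℝ]) • g := by
  rw [MulOpposite.op_neg, MulOpposite.op_one, neg_one_smul, sub_eq_add_neg]

lemma sub_mem_bmoSpace (hf : f ∈ bmoSpace) (hg : g ∈ bmoSpace) : f - g ∈ bmoSpace := by
  rw [sub_eq_add_smul]
  exact add_mem_bmoSpace hf (smul_mem_bmoSpace hg _)

lemma sliceNorm_nonneg (i : ℍ[ℝ]) (f : unitBall → ℍ[ℝ]) : 0 ≤ sliceNorm i f :=
  add_nonneg (norm_nonneg _) ENNReal.toReal_nonneg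

lemma globalNorm_nonneg (f : unitBall → ℍ[ℝ]) : 0 ≤ globalNorm f :=
  add_nonneg (norm_nonneg _) ENNReal.toReal_nonneg

lemma sliceNorm_le_globalNorm (hf : f ∈ bmoSpace) (hi : i ∈ imUnits) :
    sliceNorm i f ≤ globalNorm f := by
  unfold sliceNorm globalNorm
  have := ENNReal.toReal_mono hf.2.ne (sliceSeminorm_le_globalSeminorm (f := f) hi)
  linarith

lemma globalNorm_le_sliceNorm (hf : f ∈ bmoSpace) (hi : i ∈ imUnits) :
    globalNorm f ≤ 2 * sliceNorm i f := by
  obtain ⟨a, ha⟩ := (mem_bmoSpace_iff.1 hf).1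
  have ht := sliceSeminorm_lt_top hf hi
  have := ENNReal.toReal_mono (ENNReal.mul_lt_top ENNReal.ofNat_lt_top ht).ne
    (ha.globalSeminorm_le hi)
  rw [ENNReal.toReal_mul, ENNReal.toReal_ofNat] at this
  unfold sliceNorm globalNorm
  linarith [norm_nonneg (f center)]

/-- The norm dominates the `ℓ²` norm of the coefficients, so they all vanish. -/
lemma eq_zero_of_sliceNorm_eq_zero (hf : f ∈ bmoSpace) (hi : i ∈ imUnits)
    (h : sliceNorm i f = 0) : f = 0 := by
  obtain ⟨a, ha⟩ := (mem_bmoSpace_iff.1 hf).1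
  have h1 := ha.tsum_le_sliceNorm_sq hf hi
  rw [h] at h1
  have h2 : ∀ n, a n = 0 := by
    intro n
    have h3 := ha.1.le_tsum n fun m _ => by positivity
    have h4 : ‖a n‖ ^ 2 ≤ 0 := by linarith
    exact norm_eq_zero.1 (pow_eq_zero_iff two_ne_zero |>.1 (le_antisymm h4 (by positivity)))
  ext1 x
  have h3 := ha.2 x x.2
  rw [zeroExt_of_mem _ x.2] at h3
  simp only [h2, mul_zero] at h3
  exact h3.unique hasSum_zero

lemma sliceNorm_add_le (hf : f ∈ bmoSpace) (hg : g ∈ bmoSpace) (hi : i ∈ imUnits) :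
    sliceNorm i (f + g) ≤ sliceNorm i f + sliceNorm i g := by
  obtain ⟨a, ha⟩ := (mem_bmoSpace_iff.1 hf).1
  obtain ⟨b, hb⟩ := (mem_bmoSpace_iff.1 hg).1
  have hft := (sliceSeminorm_lt_top hf hi).ne
  have hgt := (sliceSeminorm_lt_top hg hi).ne
  have h := ENNReal.toReal_mono (ENNReal.add_ne_top.2 ⟨hft, hgt⟩) (ha.sliceSeminorm_add_le hb hi)
  rw [ENNReal.toReal_add hft hgt] at h
  have h0 := norm_add_le (f center) (g center)
  unfold sliceNorm
  rw [Pi.add_apply]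
  linarith

lemma globalNorm_add_le (hf : f ∈ bmoSpace) (hg : g ∈ bmoSpace) :
    globalNorm (f + g) ≤ globalNorm f + globalNorm g := by
  obtain ⟨a, ha⟩ := (mem_bmoSpace_iff.1 hf).1
  obtain ⟨b, hb⟩ := (mem_bmoSpace_iff.1 hg).1
  have h := ENNReal.toReal_mono (ENNReal.add_ne_top.2 ⟨hf.2.ne, hg.2.ne⟩)
    (ha.globalSeminorm_add_le hb)
  rw [ENNReal.toReal_add hf.2.ne hg.2.ne] at h
  have h0 := norm_add_le (f center) (g center)
  unfold globalNorm
  rw [Pi.add_apply]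
  linarith

lemma sliceNorm_smul (hf : f ∈ bmoSpace) (hi : i ∈ imUnits) (c : ℍ[ℝ]) :
    sliceNorm i (MulOpposite.op c • f) = sliceNorm i f * ‖c‖ := by
  obtain ⟨a, ha⟩ := (mem_bmoSpace_iff.1 hf).1
  rw [sliceNorm, sliceNorm, ha.sliceSeminorm_smul hi, ENNReal.toReal_mul, toReal_enorm, add_mul,
    Pi.smul_apply, op_smul_eq_mul, norm_mul]

lemma globalNorm_smul (hf : f ∈ bmoSpace) (c : ℍ[ℝ]) :
    globalNorm (MulOpposite.op c • f) = globalNorm f * ‖c‖ := by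
  obtain ⟨a, ha⟩ := (mem_bmoSpace_iff.1 hf).1
  rw [globalNorm, globalNorm, ha.globalSeminorm_smul, ENNReal.toReal_mul, toReal_enorm, add_mul,
    Pi.smul_apply, op_smul_eq_mul, norm_mul]

/-! ### Completeness -/

lemma norm_sq_eq_tsum (A : lp (fun _ : ℕ => ℍ[ℝ]) 2) : ‖A‖ ^ 2 = ∑' n, ‖A n‖ ^ 2 := by
  have := lp.norm_rpow_eq_tsum (p := 2) (by norm_num) A
  simpa using this

/-- A sequence in `bmoSpace` that is Cauchy for the norm of a slice converges in the Hardy space. -/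
lemma exists_hardy_limit (hi : i ∈ imUnits) {u : ℕ → unitBall → ℍ[ℝ]} (hu : ∀ n, u n ∈ bmoSpace)
    {a : ℕ → ℕ → ℍ[ℝ]} (ha : ∀ n, HasCoeff (u n) (a n))
    (hc : ∀ ε > 0, ∃ n₀, ∀ m ≥ n₀, ∀ n ≥ n₀, sliceNorm i (u m - u n) < ε) :
    ∃ (f : unitBall → ℍ[ℝ]) (b : ℕ → ℍ[ℝ]), HasCoeff f b ∧
      Tendsto (fun n => ∑' k, ‖a n k - b k‖ ^ 2) atTop (𝓝 0) := by
  have hmem : ∀ n, Memℓp (a n) 2 := fun n => memℓp_gen (by simpa using (ha n).1)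
  let A : ℕ → lp (fun _ : ℕ => ℍ[ℝ]) 2 := fun n => ⟨a n, hmem n⟩
  -- The BMO norm dominates the `ℓ²` norm of the coefficients, so the Cauchy property passes to
  -- `ℓ²`, which is complete.
  have hA : CauchySeq A := by
    rw [Metric.cauchySeq_iff]
    intro ε hε
    obtain ⟨N, hN⟩ := hc ε hε
    refine ⟨N, fun m hm n hn => ?_⟩
    have h1 : ‖A m - A n‖ ^ 2 ≤ sliceNorm i (u m - u n) ^ 2 := by
      rw [norm_sq_eq_tsum]
      exact ((ha m).sub (ha n)).tsum_le_sliceNorm_sq (sub_mem_bmoSpace (hu m) (hu n)) hi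
    rw [dist_eq_norm]
    exact (le_of_sq_le_sq h1 (sliceNorm_nonneg _ _)).trans_lt (hN m hm n hn)
  obtain ⟨B, hB⟩ := cauchySeq_tendsto_of_complete hA
  have hBs : Summable fun k => ‖B k‖ ^ 2 := by
    have := (lp.memℓp B).summable (by norm_num)
    simpa using this
  obtain ⟨f, hf⟩ := exists_hasCoeff hBs
  refine ⟨f, B, hf, ?_⟩
  have h2 := ((tendsto_iff_norm_sub_tendsto_zero.1 hB).pow 2)
  simp_rw [norm_sq_eq_tsum] at h2
  simpa [A] using! h2

/-- The oscillation over a fixed interval is controlled by the Hardy norm. -/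
lemma tendsto_oscil_zero (hi : i ∈ imUnits) {v : ℕ → unitBall → ℍ[ℝ]} {a : ℕ → ℕ → ℍ[ℝ]}
    (hv : ∀ n, HasCoeff (v n) (a n)) (h : Tendsto (fun n => ∑' k, ‖a n k‖ ^ 2) atTop (𝓝 0))
    {c d : ℝ} (hcd : c < d) (hd : d - c ≤ 2 * Real.pi) :
    Tendsto (fun n => oscil (radialLimit (v n) i) c d) atTop (𝓝 0) := by
  have h1 : Tendsto (fun n => ENNReal.ofReal (1 / (d - c)) ^ (1 / 2 : ℝ) *
      (2 * ENNReal.ofReal (2 * Real.pi * ∑' k, ‖a n k‖ ^ 2) ^ (1 / 2 : ℝ))) atTop (𝓝 0) := by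
    have h2 := ENNReal.tendsto_ofReal (h.const_mul (2 * Real.pi))
    have h3 := h2.ennrpow_const (1 / 2 : ℝ)
    rw [mul_zero, ENNReal.ofReal_zero, ENNReal.zero_rpow_of_pos (by norm_num)] at h3
    have h4 := ENNReal.Tendsto.const_mul (a := 2) h3 (Or.inr ENNReal.ofNat_ne_top)
    have h5 := ENNReal.Tendsto.const_mul (a := ENNReal.ofReal (1 / (d - c)) ^ (1 / 2 : ℝ)) h4
      (Or.inr (ENNReal.rpow_ne_top_of_nonneg (by norm_num) ENNReal.ofReal_ne_top))
    simpa using h5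
  refine tendsto_of_tendsto_of_tendsto_of_le_of_le tendsto_const_nhds h1 (fun _ => zero_le)
    fun n => ?_
  refine (oscil_le_eLpNorm hcd ((hv n).memLp hi hd)).trans ?_
  gcongr
  have h6 := ENNReal.rpow_le_rpow ((hv n).eLpNorm_radialLimit_sq_le hi hd)
    (by norm_num : (0 : ℝ) ≤ 1 / 2)
  rwa [sq_rpow_half] at h6

/-- Completeness of `bmoSpace` for the norm of a slice. -/
lemma exists_tendsto_sliceNorm (hi : i ∈ imUnits) {u : ℕ → unitBall → ℍ[ℝ]}
    (hu : ∀ n, u n ∈ bmoSpace)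
    (hc : ∀ ε > 0, ∃ n₀, ∀ m ≥ n₀, ∀ n ≥ n₀, sliceNorm i (u m - u n) < ε) :
    ∃ f ∈ bmoSpace, Tendsto (fun n => sliceNorm i (u n - f)) atTop (𝓝 0) := by
  choose a ha using fun n => (mem_bmoSpace_iff.1 (hu n)).1
  obtain ⟨f, b, hf, hlim⟩ := exists_hardy_limit hi hu ha hc
  have hosc := fun {c d : ℝ} => tendsto_oscil_zero (c := c) (d := d) hi
    (fun n => (ha n).sub hf) hlim
  have key : ∀ ε > 0, ∃ n₀, ∀ n ≥ n₀, sliceSeminorm i (u n - f) ≤ ENNReal.ofReal ε := by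
    intro ε hε
    obtain ⟨N, hN⟩ := hc ε hε
    refine ⟨N, fun n hn => sliceSeminorm_le_iff.2 fun c d hcd hd => ?_⟩
    have h1 := (hosc hcd hd).const_add (ENNReal.ofReal ε)
    rw [add_zero] at h1
    -- Here `n` and the interval are fixed while `m → ∞`: splitting `u n - f` through `u m` leaves
    -- an error that vanishes in the Hardy norm. The index `N` does not depend on the interval.
    refine ge_of_tendsto h1 ?_
    filter_upwards [eventually_ge_atTop N] with m hm
    have h2 := ((ha n).sub (ha m)).oscil_add_le ((ha m).sub hf) hi hd
    rw [sub_add_sub_cancel] at h2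
    refine h2.trans ?_
    gcongr
    refine (oscil_le_sliceSeminorm i _ hcd hd).trans ?_
    rw [← ENNReal.ofReal_toReal (sliceSeminorm_lt_top (sub_mem_bmoSpace (hu n) (hu m)) hi).ne]
    refine ENNReal.ofReal_le_ofReal (le_trans ?_ (hN n hn m hm).le)
    exact le_add_of_nonneg_left (norm_nonneg _)
  -- The seminorm of `f = u N - (u N - f)` is finite on the slice of `i`, hence on all slices by the
  -- factor 2 comparison.
  have hmem : f ∈ bmoSpace := by
    obtain ⟨N, hN⟩ := key 1 one_pos
    refine mem_bmoSpace_iff.2 ⟨⟨b, hf⟩, (hf.globalSeminorm_le hi).trans_lt ?_⟩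
    refine ENNReal.mul_lt_top ENNReal.ofNat_lt_top ?_
    have hd := (ha N).sub hf
    have h1 := (ha N).sliceSeminorm_add_le (hd.smul (-1)) hi
    rw [← sub_eq_add_smul, sub_sub_cancel, hd.sliceSeminorm_smul hi] at h1
    refine h1.trans_lt (ENNReal.add_lt_top.2 ⟨sliceSeminorm_lt_top (hu N) hi, ?_⟩)
    exact ENNReal.mul_lt_top ((hN N le_rfl).trans_lt ENNReal.ofReal_lt_top) enorm_lt_top
  refine ⟨f, hmem, ?_⟩
  have h0 : Tendsto (fun n => ‖(u n - f) center‖) atTop (𝓝 0) := by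
    have h1 := hlim.sqrt
    rw [Real.sqrt_zero] at h1
    refine squeeze_zero (fun n => norm_nonneg _) (fun n => ?_) h1
    rw [((ha n).sub hf).coeff_zero]
    exact Real.le_sqrt_of_sq_le (((ha n).sub hf).1.le_tsum 0 fun m _ => by positivity)
  have h1 : Tendsto (fun n => (sliceSeminorm i (u n - f)).toReal) atTop (𝓝 0) := by
    rw [Metric.tendsto_atTop]
    intro ε hε
    -- Halving turns the weak bound of `key` into the strict one required.
    obtain ⟨N, hN⟩ := key (ε / 2) (half_pos hε)
    refine ⟨N, fun n hn => ?_⟩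
    rw [Real.dist_0_eq_abs, abs_of_nonneg ENNReal.toReal_nonneg]
    have := ENNReal.toReal_le_of_le_ofReal (half_pos hε).le (hN n hn)
    linarith
  simpa [sliceNorm] using h0.add h1

/-! ### The Banach space structures -/

lemma sliceNorm_zero (hi : i ∈ imUnits) : sliceNorm i 0 = 0 := by
  have h := sliceNorm_smul zero_mem_bmoSpace hi 0
  rwa [smul_zero, norm_zero, mul_zero] at h

lemma globalNorm_zero : globalNorm 0 = 0 := by
  have h := globalNorm_smul zero_mem_bmoSpace 0
  rwa [smul_zero, norm_zero, mul_zero] at h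

theorem isRightBanachSpace_sliceNorm (hi : i ∈ imUnits) :
    IsRightBanachSpace bmoSpace (sliceNorm i) where
  zero_mem := zero_mem_bmoSpace
  add_mem _ hf _ hg := add_mem_bmoSpace hf hg
  smul_mem _ hf c := smul_mem_bmoSpace hf c
  nonneg f _ := sliceNorm_nonneg i f
  eq_zero_iff _ hf := ⟨eq_zero_of_sliceNorm_eq_zero hf hi, fun h => h ▸ sliceNorm_zero hi⟩
  add_le _ hf _ hg := sliceNorm_add_le hf hg hi
  smul_eq _ hf c := sliceNorm_smul hf hi c
  complete _ hu hc := exists_tendsto_sliceNorm hi hu hc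

theorem isRightBanachSpace_globalNorm : IsRightBanachSpace bmoSpace globalNorm := by
  obtain ⟨i, hi⟩ := exists_mem_imUnits
  exact
  { zero_mem := zero_mem_bmoSpace
    add_mem := fun _ hf _ hg => add_mem_bmoSpace hf hg
    smul_mem := fun _ hf c => smul_mem_bmoSpace hf c
    nonneg := fun f _ => globalNorm_nonneg f
    eq_zero_iff := fun f hf => ⟨fun h => eq_zero_of_sliceNorm_eq_zero hf hi
      (le_antisymm (h ▸ sliceNorm_le_globalNorm hf hi) (sliceNorm_nonneg i f)),
      fun h => h ▸ globalNorm_zero⟩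
    add_le := fun _ hf _ hg => globalNorm_add_le hf hg
    smul_eq := fun _ hf c => globalNorm_smul hf c
    complete := by
      intro u hu hc
      -- A globally Cauchy sequence is Cauchy on one arbitrary slice; the limit found there is a
      -- global limit because the global norm is at most twice the slice norm.
      obtain ⟨f, hf, hlim⟩ := exists_tendsto_sliceNorm hi hu fun ε hε => by
        obtain ⟨N, hN⟩ := hc ε hε
        exact ⟨N, fun m hm n hn =>
          (sliceNorm_le_globalNorm (sub_mem_bmoSpace (hu m) (hu n)) hi).trans_lt (hN m hm n hn)⟩
      refine ⟨f, hf, squeeze_zero (fun n => globalNorm_nonneg _)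
        (fun n => globalNorm_le_sliceNorm (sub_mem_bmoSpace (hu n) hf) hi) ?_⟩
      simpa using hlim.const_mul 2 }

end

end BMOSH

end

theorem mainTheorem7 :
    (∀ i ∈ BMOSH.imUnits,
      BMOSH.IsRightBanachSpace BMOSH.bmoSpace (BMOSH.sliceNorm i)) ∧
    BMOSH.IsRightBanachSpace BMOSH.bmoSpace BMOSH.globalNorm ∧
    (∀ i ∈ BMOSH.imUnits,
      BMOSH.EquivalentOn BMOSH.bmoSpace (BMOSH.sliceNorm i) BMOSH.globalNorm) := by
  refine ⟨fun i hi => BMOSH.isRightBanachSpace_sliceNorm hi, BMOSH.isRightBanachSpace_globalNorm,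
    fun i hi => ⟨1, one_pos, 2, two_pos, fun f hf => ⟨?_, BMOSH.globalNorm_le_sliceNorm hf hi⟩⟩⟩
  rw [one_mul]
  exact BMOSH.sliceNorm_le_globalNorm hf hi
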